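/- **Setting.** Let $U_0,U_1,\dots$ and $V_0,V_1,\dots$ be two independent i.i.d. sequences of nonnegative random variables with $\mathbb E[U_n]=\mathbb E[V_n]=1$ and $\mathbb E[e^{\eta U_n}],\mathbb E[e^{\eta V_n}]<\infty$ for some $\eta>0$. For a fee $p\in[\underline p,\bar p]$ and a service rate $\mu\in[\underline\mu,\bar\mu]$ ($\underline p<\bar p$, $\underline\mu<\bar\mu$), consider the FIFO $GI/GI/1$ queue with interarrival times $U_n/\lambda(p)$ and service times $V_n/\mu$, where $\lambda>0$ is continuously differentiable and non-increasing on $[\underline p,\bar p]$ and the staffing cost $c$ is continuously differentiable and non-decreasing on $[\underline\mu,\bar\mu]$. (At endpoints of these intervals, derivatives of $\lambda$, $c$ and $f$ are one-sided.) The waiting time $W_n$ and the age $X_n$ of the busy period observed by customer $n$ on arrival satisfy $$W_{n+1}=\Bigl(W_n+\frac{V_n}{\mu}-\frac{U_n}{\lambda(p)}\Bigr)^+,\qquad X_{n+1}=\Bigl(X_n+\frac{U_n}{\lambda(p)}\Bigr)\mathbf 1_{\{W_{n+1}>0\}},$$ and $(W_\infty,X_\infty)=(W_\infty(\mu,p),X_\infty(\mu,p))$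 has the stationary law of the Markov chain $(W_n,X_n)$. Let $$f(\mu,p)=h_0\,\mathbb E[Q_\infty(\mu,p)]+c(\mu)-p\lambda(p),$$ where $h_0\in\mathbb R$ and $\mathbb E[Q_\infty]$ is the steady-state mean number of customers in the system in continuous time, i.e. the limit in probability of $T^{-1}\int_0^TQ(t)\,dt$ as $T\to\infty$ when customer $0$ arrives to an empty system at time $0$. **Lemma.** Suppose that the queue is stable at $(\mu,p)\in[\underline\mu,\bar\mu]\times[\underline p,\bar p]$, that is, $\lambda(p)<\mu$. Then the stationary law of $(W_n,X_n)$ exists and is unique, $W_\infty$ and $X_\infty$ are integrable, $\mathbb E[Q_\infty]$ exists, and $f(\mu,p)=h_0\lambda(p)\bigl(\mathbb E[W_\infty]+\tfrac1\mu\bigr)+c(\mu)-p\lambda(p)$. Put $$D_p=-\lambda(p)-p\lambda'(p)+h_0\lambda'(p)\Bigl(\mathbb E[W_\infty]+\mathbb E[X_\infty]+\frac1\mu\Bigr),$$ $$D_\mu=c'(\mu)-h_0\frac{\lambda(p)}{\mu}\Bigl(\mathbb E[W_\infty]+\mathbb E[X_\infty]+\frac1\mu\Bigr).$$ 1. For $p<\bar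 p$ the right-hand partial derivative of $f$ in $p$ at $(\mu,p)$ exists and equals $D_p$; for $\mu<\bar\mu$ the right-hand partial derivative of $f$ in $\mu$ at $(\mu,p)$ exists and equals $D_\mu$. 2. Hence, if $p<\bar p$ and $\partial f/\partial p$ exists at $(\mu,p)$, then $\frac{\partial f}{\partial p}(\mu,p)=D_p$; if $\mu<\bar\mu$ and $\partial f/\partial\mu$ exists at $(\mu,p)$, then $\frac{\partial f}{\partial\mu}(\mu,p)=D_\mu$. 3. If $\mathbb P\bigl(W_\infty+V/\mu=U/\lambda(p),\ U>0\bigr)=0$, where $U,V$ are distributed as $U_0,V_0$ and $W_\infty,U,V$ are independent (for instance, if $U_0$ or $V_0$ has no atoms), then both partial derivatives exist at $(\mu,p)$, and $\frac{\partial f}{\partial p}(\mu,p)=D_p$, $\frac{\partial f}{\partial\mu}(\mu,p)=D_\mu$. -/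

import Mathlib

open MeasureTheory ProbabilityTheory Filter Topology
open scoped ENNReal

namespace GIGIOne

/-- The primitives of the queue: two independent i.i.d. sequences of nonnegative random variables
with unit means. `U n` is the (unscaled) time between the arrivals of customers `n` and `n + 1`,
`V n` is the (unscaled) service requirement of customer `n`. -/
structure IsInput {Ω : Type*} [MeasurableSpace Ω] (P : Measure Ω) (U V : ℕ → Ω → ℝ) : Prop where
  measurable_U : ∀ n, Measurable (U n)
  measurable_V : ∀ n, Measurable (V n)
  /-- all the variables `U 0, U 1, …, V 0, V 1, …` are mutually independent -/
  indep : iIndepFun (Sum.elim U V) P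
  ident_U : ∀ n, IdentDistrib (U n) (U 0) P P
  ident_V : ∀ n, IdentDistrib (V n) (V 0) P P
  nonneg_U : ∀ᵐ ω ∂P, 0 ≤ U 0 ω
  nonneg_V : ∀ᵐ ω ∂P, 0 ≤ V 0 ω
  mean_U : ∫ ω, U 0 ω ∂P = 1
  mean_V : ∫ ω, V 0 ω ∂P = 1

/-- Light tails: `E[exp (η U)]` and `E[exp (η V)]` are finite for some `η > 0`. -/
def LightTailed {Ω : Type*} [MeasurableSpace Ω] (P : Measure Ω) (U V : ℕ → Ω → ℝ) : Prop :=
  ∃ η : ℝ, 0 < η ∧ Integrable (fun ω => Real.exp (η * U 0 ω)) P ∧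
    Integrable (fun ω => Real.exp (η * V 0 ω)) P

/-- One step of the recursion for (waiting time, observed age of the busy period), with arrival
rate `l` and service rate `m`: from `(w, x)` and the primitives `(u, v)` to `(w', x')`, where
`w' = (w + v / m - u / l)⁺` and `x' = (x + u / l) 1_{w' > 0}`. -/
noncomputable def step (l m : ℝ) (s : ℝ × ℝ) (a : ℝ × ℝ) : ℝ × ℝ :=
  (max (s.1 + a.2 / m - a.1 / l) 0,
    if 0 < max (s.1 + a.2 / m - a.1 / l) 0 then s.2 + a.1 / l else 0)

/-- `π` is a stationary distribution of the Markov chain `(W_n, X_n)` driven by `step`, when the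
interarrival and service primitives are independent with laws `νU` and `νV`. -/
def IsSteadyState (νU νV : Measure ℝ) (l m : ℝ) (π : Measure (ℝ × ℝ)) : Prop :=
  IsProbabilityMeasure π ∧
    Measure.map (fun z : (ℝ × ℝ) × (ℝ × ℝ) => step l m z.1 z.2) (π.prod (νU.prod νV)) = π

open Classical in
/-- The law of `(W_∞, X_∞)` (the zero measure if there is no stationary distribution). -/
noncomputable def steadyState (νU νV : Measure ℝ) (l m : ℝ) : Measure (ℝ × ℝ) :=
  if h : ∃ π, IsSteadyState νU νV l m π then h.choose else 0

/-- `E[W_∞]`, the mean stationary waiting time. -/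
noncomputable def meanWait (νU νV : Measure ℝ) (l m : ℝ) : ℝ :=
  ∫ z, z.1 ∂(steadyState νU νV l m)

/-- `E[X_∞]`, the mean stationary observed age of the busy period. -/
noncomputable def meanAge (νU νV : Measure ℝ) (l m : ℝ) : ℝ :=
  ∫ z, z.2 ∂(steadyState νU νV l m)

/-- `P(W_∞ + V / m = U / l, U > 0) = 0`, with `W_∞`, `U`, `V` independent: in steady state an
arrival almost surely does not fall on the very instant at which the system empties. -/
def NoTies (νU νV : Measure ℝ) (l m : ℝ) : Prop :=
  ((steadyState νU νV l m).prod (νU.prod νV))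
    {z | z.1.1 + z.2.2 / m = z.2.1 / l ∧ 0 < z.2.1} = 0

section Path

variable {Ω : Type*} (U V : ℕ → Ω → ℝ) (l m : ℝ)

/-- The pair `(W_n, X_n)` of customer `n`, when customer `0` finds the system empty. -/
noncomputable def state : ℕ → Ω → ℝ × ℝ
  | 0, _ => (0, 0)
  | n + 1, ω => step l m (state n ω) (U n ω, V n ω)

/-- Arrival time of customer `n`; customer `0` arrives at time `0`. -/
noncomputable def arrival (n : ℕ) (ω : Ω) : ℝ := ∑ i ∈ Finset.range n, U i ω / l

/-- Departure time of customer `n`: arrival time, plus waiting time, plus service time. -/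
noncomputable def departure (n : ℕ) (ω : Ω) : ℝ :=
  arrival U l n ω + (state U V l m n ω).1 + V n ω / m

/-- Number of customers in the system (waiting or in service) at time `t`. -/
noncomputable def numInSystem (t : ℝ) (ω : Ω) : ℝ≥0∞ :=
  ∑' n : ℕ, (Set.Ico (arrival U l n ω) (departure U V l m n ω)).indicator (fun _ => 1) t

/-- `q` is the steady-state mean number in system in continuous time: the time average
`T⁻¹ ∫₀ᵀ Q(t) dt` converges to `q` in probability as `T → ∞`. -/
def IsMeanQueue [MeasurableSpace Ω] (P : Measure Ω) (q : ℝ) : Prop :=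
  TendstoInMeasure P
    (fun (T : ℝ) ω => T⁻¹ * (∫⁻ t in Set.Icc 0 T, numInSystem U V l m t ω).toReal)
    atTop (fun _ => q)

open Classical in
/-- `E[Q_∞]` (zero if the long-run average does not exist). -/
noncomputable def meanQueue [MeasurableSpace Ω] (P : Measure Ω) : ℝ :=
  if h : ∃ q, IsMeanQueue U V l m P q then h.choose else 0

end Path

/-- The objective `f(μ, p) = h₀ E[Q_∞(μ, p)] + c(μ) - p λ(p)`. -/
noncomputable def objective {Ω : Type*} [MeasurableSpace Ω] (P : Measure Ω) (U V : ℕ → Ω → ℝ)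
    (h0 : ℝ) (lam c : ℝ → ℝ) (mu p : ℝ) : ℝ :=
  h0 * meanQueue U V (lam p) mu P + c mu - p * lam p

end GIGIOne

/-! Running the recursion backwards in time (Loynes' construction) makes the stationary state
explicit. Let S_k be the sum over i < k of V_i/μ - U_i/λ; by stability and light tails this walk
tends to -∞. The pair formed by max_k S_k and the total interarrival time up to the first maximizer
τ is reproduced by one step of the recursion (`limState_eq_step`), and backward trajectories from
any initial state reach it after finitely many steps (`eventually_runBack_eq`). So the stationary
law exists, is unique and is the law of this pair; in particular E[W] = E[max_k S_k].

For fixed inputs, max_k S_k is an upper envelope of lines: in s = 1/λ with slopes -(U_0+…+U_{k-1}),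
in s = -1/μ with slopes -(V_0+…+V_{k-1}). The slopes decrease in k, so just to the right of s the
first maximizer wins, and the right derivatives are -(U_0+…+U_{τ-1}) = -λX and -(V_0+…+V_{τ-1}) =
-μ(W+X). Difference quotients are bounded by a multiple of the envelope at a nearby, still stable
parameter, which is integrable, so the derivative passes under the expectation
(`hasDerivWithinAt_integral_envelope`). Maximizers with different sums require an arrival exactly
when the system empties; without such ties the derivative is two-sided (`sum_eq_of_isMax`).

Little's law (`isMeanQueue`) gives E[Q] = λ(E[W] + 1/μ): the integral of Q over [0,T] lies between
the total sojourn times of slightly fewer and slightly more than λT customers, and average sojourn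
times converge by superadditivity. The chain rule then yields both formulas; since λ(p) is
non-increasing, moving p to the right moves 1/λ(p) to the right. -/

namespace GIGIOne

/-! ### I.i.d. sequences: shifts, prepending, independence of blocks. -/

section Sequences

variable {α : Type*} [MeasurableSpace α]

/-- The law of an i.i.d. sequence with marginal law `ν`. -/
noncomputable def iidLaw (ν : Measure α) : Measure (ℕ → α) := Measure.infinitePi fun _ => ν

instance (ν : Measure α) [IsProbabilityMeasure ν] : IsProbabilityMeasure (iidLaw ν) := by
  unfold iidLaw; infer_instance

/-- The sequence without its first `n` terms. -/
def drop {α : Type*} (n : ℕ) (a : ℕ → α) : ℕ → α := fun i => a (n + i)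

@[fun_prop]
lemma measurable_drop (n : ℕ) : Measurable (drop (α := α) n) := by
  unfold drop; fun_prop

lemma measurePreserving_drop (ν : Measure α) [IsProbabilityMeasure ν] (n : ℕ) :
    MeasurePreserving (drop n) (iidLaw ν) (iidLaw ν) :=
  ⟨measurable_drop n, Measure.map_infinitePi_infinitePi_of_inj (P := fun _ : ℕ => ν)
    (f := fun i => n + i) (add_right_injective n)⟩

lemma measurePreserving_eval (ν : Measure α) [IsProbabilityMeasure ν] (n : ℕ) :
    MeasurePreserving (fun a : ℕ → α => a n) (iidLaw ν) ν :=
  measurePreserving_eval_infinitePi (fun _ : ℕ => ν) n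

/-- Prepend a term to a sequence. -/
def cons {α : Type*} (x : α) (a : ℕ → α) : ℕ → α
  | 0 => x
  | n + 1 => a n

lemma measurable_cons : Measurable fun z : α × (ℕ → α) => cons z.1 z.2 := by
  refine measurable_pi_lambda _ fun n => ?_
  cases n with
  | zero => exact measurable_fst
  | succ n => exact (measurable_pi_apply n).comp measurable_snd

lemma map_cons (ν : Measure α) [IsProbabilityMeasure ν] :
    (ν.prod (iidLaw ν)).map (fun z => cons z.1 z.2) = iidLaw ν := by
  classical
  refine Measure.eq_infinitePi _ fun s t ht => ?_
  have hs : MeasurableSet (Set.pi (s : Set ℕ) t) :=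
    MeasurableSet.pi s.countable_toSet fun i _ => ht i
  rw [Measure.map_apply measurable_cons hs]
  set s' : Finset ℕ := s.preimage Nat.succ Nat.succ_injective.injOn with hs'
  have hpre : (fun z : α × (ℕ → α) => cons z.1 z.2) ⁻¹' (Set.pi (s : Set ℕ) t)
      = (if 0 ∈ s then t 0 else Set.univ) ×ˢ Set.pi (s' : Set ℕ) (fun i => t (i + 1)) := by
    ext ⟨x, a⟩
    simp only [Set.mem_preimage, Set.mem_pi, Set.mem_prod, Finset.mem_coe, hs',
      Finset.mem_preimage]
    constructor
    · intro h
      refine ⟨?_, fun i hi => h (i + 1) hi⟩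
      split_ifs with h0
      · exact h 0 h0
      · trivial
    · rintro ⟨h0, h1⟩ i hi
      cases i with
      | zero => simpa [hi, cons] using h0
      | succ i => exact h1 i hi
  rw [hpre, Measure.prod_prod, iidLaw, Measure.infinitePi_pi _ fun i _ => ht (i + 1)]
  have himg : s.erase 0 = s'.image Nat.succ := by
    ext i
    cases i <;> simp [hs']
  have hprod : ∏ i ∈ s', ν (t (i + 1)) = ∏ i ∈ s.erase 0, ν (t i) := by
    rw [himg, Finset.prod_image (by simp)]
  rw [hprod]
  split_ifs with h0
  · exact Finset.mul_prod_erase s (fun i => ν (t i)) h0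
  · rw [measure_univ, one_mul, Finset.erase_eq_of_notMem h0]

lemma map_eval_zero_drop_one (ν : Measure α) [IsProbabilityMeasure ν] :
    (iidLaw ν).map (fun a => (a 0, drop 1 a)) = ν.prod (iidLaw ν) := by
  conv_lhs => rw [← map_cons ν]
  rw [Measure.map_map (by fun_prop) measurable_cons]
  convert Measure.map_id
  ext z i
  · rfl
  · simp [drop, cons, Nat.add_comm 1]

lemma indepFun_of_dependsOn (ν : Measure α) [IsProbabilityMeasure ν] [Inhabited α]
    {β γ : Type*} [MeasurableSpace β] [MeasurableSpace γ] {f : (ℕ → α) → β} {g : (ℕ → α) → γ}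
    (hf : Measurable f) (hg : Measurable g) {s t : Finset ℕ} (hst : Disjoint s t)
    (hfs : DependsOn f s) (hgt : DependsOn g t) : IndepFun f g (iidLaw ν) := by
  classical
  have h := (iIndepFun_infinitePi (P := fun _ : ℕ => ν) (X := fun _ x => x)
    (fun _ => measurable_id)).indepFun_finset s t hst (fun i => measurable_pi_apply i)
  -- Independence is known for restrictions to finite index sets. A function depending only on `s`
  -- factors through the restriction to `s`, and the filler `default` is never seen.
  let ext (s : Finset ℕ) (r : s → α) : ℕ → α := fun i => if h : i ∈ s then r ⟨i, h⟩ else default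
  have hext (s : Finset ℕ) : Measurable (ext s) := by
    refine measurable_pi_lambda _ fun i => ?_
    by_cases h : i ∈ s
    · simpa [ext, h] using measurable_pi_apply _
    · simp [ext, h]
  have h2 := h.comp (φ := f ∘ ext s) (ψ := g ∘ ext t) (hf.comp (hext s)) (hg.comp (hext t))
  have e1 : (f ∘ ext s) ∘ (fun (a : ℕ → α) (i : s) => a i) = f := by
    ext1 a
    exact hfs fun i hi => by simp [ext, Finset.mem_coe.1 hi]
  have e2 : (g ∘ ext t) ∘ (fun (a : ℕ → α) (i : t) => a i) = g := by
    ext1 a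
    exact hgt fun i hi => by simp [ext, Finset.mem_coe.1 hi]
  rwa [e1, e2] at h2

end Sequences

/-- Reindexing the joint family by ℕ × Bool and currying turns mutual independence into an i.i.d.
sequence of independent pairs, so every almost sure statement can be proved on the canonical
sequence space. -/
lemma IsInput.map_eq_iidLaw {Ω : Type*} [MeasurableSpace Ω] {P : Measure Ω}
    [IsProbabilityMeasure P] {U V : ℕ → Ω → ℝ} (h : IsInput P U V) :
    P.map (fun ω n => (U n ω, V n ω)) = iidLaw ((P.map (U 0)).prod (P.map (V 0))) := by
  let e : ℕ × Bool → ℕ ⊕ ℕ := fun z => bif z.2 then Sum.inl z.1 else Sum.inr z.1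
  have he : Function.Injective e := by
    rintro ⟨n, b⟩ ⟨m, c⟩ hnm
    cases b <;> cases c <;> simp_all [e]
  let ν : Bool → Measure ℝ := fun b => bif b then P.map (U 0) else P.map (V 0)
  have hνp : ∀ b, IsProbabilityMeasure (ν b) := by
    rintro (_ | _)
    · exact Measure.isProbabilityMeasure_map (h.measurable_V 0).aemeasurable
    · exact Measure.isProbabilityMeasure_map (h.measurable_U 0).aemeasurable
  have hm : ∀ z, Measurable (Sum.elim U V (e z)) := by
    rintro ⟨n, _ | _⟩
    · exact h.measurable_V n
    · exact h.measurable_U n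
  have h1 := (iIndepFun_iff_map_fun_eq_infinitePi_map hm).1 (h.indep.precomp he)
  have h2 : (fun z => P.map (Sum.elim U V (e z))) = fun z : ℕ × Bool => ν z.2 := by
    ext1 ⟨n, b⟩
    cases b
    · exact (h.ident_V n).map_eq
    · exact (h.ident_U n).map_eq
  simp only [h2] at h1
  have h3 := congrArg (Measure.map (MeasurableEquiv.curry ℕ Bool ℝ)) h1
  rw [Measure.infinitePi_map_curry (fun (_ : ℕ) b => ν b),
    Measure.map_map (by fun_prop) (by fun_prop)] at h3
  have hf : Measurable fun r : Bool → ℝ => (r true, r false) := by fun_prop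
  have h4 := congrArg (Measure.map fun (g : ℕ → Bool → ℝ) n => (g n true, g n false)) h3
  have h5 := Measure.infinitePi_map_pi (μ := fun _ : ℕ => Measure.infinitePi ν)
    (f := fun _ r => (r true, r false)) (fun _ => hf)
  rw [h5, Measure.map_map (by fun_prop) (by fun_prop)] at h4
  rw [iidLaw]
  have h6 := Measure.infinitePi_map_eval_prod (P := ν) (i := true) (j := false) (by simp)
  simp only [h6] at h4
  exact h4

/-! ### First maximizer of a sequence tending to -∞. -/

section FirstMax

/-- The first index at which a sequence attains its maximum. -/
noncomputable def firstMax (r : ℕ → ℝ) : ℕ := sInf {k | ∀ j, r j ≤ r k}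

variable {r : ℕ → ℝ}

lemma le_firstMax (h : Tendsto r atTop atBot) (j : ℕ) : r j ≤ r (firstMax r) := by
  -- Divergence to -∞ makes the set of maximizers nonempty; otherwise `sInf` would return the
  -- meaningless value 0.
  rw [← Nat.cofinite_eq_atTop] at h
  exact Nat.sInf_mem (s := {k | ∀ j, r j ≤ r k}) h.exists_forall_ge j

lemma firstMax_le {k : ℕ} (h : ∀ j, r j ≤ r k) : firstMax r ≤ k := Nat.sInf_le h

lemma bddAbove_of_tendsto_atBot (h : Tendsto r atTop atBot) : BddAbove (Set.range r) :=
  ⟨_, Set.forall_mem_range.2 (le_firstMax h)⟩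

lemma iSup_eq_firstMax (h : Tendsto r atTop atBot) : ⨆ k, r k = r (firstMax r) :=
  le_antisymm (ciSup_le (le_firstMax h)) (le_ciSup (bddAbove_of_tendsto_atBot h) _)

lemma iSup_eq_of_forall_le {k : ℕ} (h : ∀ j, r j ≤ r k) : ⨆ j, r j = r k :=
  le_antisymm (ciSup_le h) (le_ciSup ⟨_, Set.forall_mem_range.2 h⟩ _)

end FirstMax

/-! ### Forward and backward recursion, and coupling. -/

section Dynamics

variable (l m : ℝ)

/-- The state after `n` steps from `z` with inputs `a 0, …, a (n - 1)`, in this order. -/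
noncomputable def run : ℕ → ℝ × ℝ → (ℕ → ℝ × ℝ) → ℝ × ℝ
  | 0, z, _ => z
  | n + 1, z, a => step l m (run n z a) (a n)

/-- The state after `n` steps from `z` with inputs `a (n - 1), …, a 0`, in this order. -/
noncomputable def runBack : ℕ → ℝ × ℝ → (ℕ → ℝ × ℝ) → ℝ × ℝ
  | 0, z, _ => z
  | n + 1, z, a => step l m (runBack n z (drop 1 a)) (a 0)

/-- The random walk with steps `v / m - u / l`. -/
noncomputable def walk (a : ℕ → ℝ × ℝ) (k : ℕ) : ℝ :=
  ∑ i ∈ Finset.range k, ((a i).2 / m - (a i).1 / l)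

/-- The limit of the backward iteration: the maximum of the walk, and the total interarrival time
up to the first index at which it is attained. -/
noncomputable def limState (a : ℕ → ℝ × ℝ) : ℝ × ℝ :=
  (⨆ k, walk l m a k, ∑ i ∈ Finset.range (firstMax (walk l m a)), (a i).1 / l)

variable {l m}

lemma walk_zero (a : ℕ → ℝ × ℝ) : walk l m a 0 = 0 := by simp [walk]

lemma walk_add (a : ℕ → ℝ × ℝ) (n k : ℕ) :
    walk l m a (n + k) = walk l m a n + walk l m (drop n a) k := by
  simp only [walk, drop, Finset.sum_range_add]

lemma walk_succ' (a : ℕ → ℝ × ℝ) (k : ℕ) :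
    walk l m a (k + 1) = walk l m (drop 1 a) k + ((a 0).2 / m - (a 0).1 / l) := by
  rw [add_comm k 1, walk_add]
  simp [walk, add_comm]

lemma drop_drop {α : Type*} (n k : ℕ) (a : ℕ → α) : drop n (drop k a) = drop (k + n) a := by
  ext i; simp [drop, add_assoc]

lemma drop_zero {α : Type*} (a : ℕ → α) : drop 0 a = a := by
  ext i; simp [drop]

lemma tendsto_walk_drop {a : ℕ → ℝ × ℝ} (h : Tendsto (walk l m a) atTop atBot) (n : ℕ) :
    Tendsto (walk l m (drop n a)) atTop atBot := by
  have h1 : Tendsto (fun k => walk l m a (k + n)) atTop atBot := h.comp (tendsto_add_atTop_nat n)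
  have h2 : walk l m (drop n a) = fun k => walk l m a (k + n) + -walk l m a n := by
    ext k; rw [add_comm k n, walk_add]; ring
  rw [h2]
  exact tendsto_atBot_add_const_right _ _ h1

lemma step_of_pos {s x : ℝ × ℝ} (h : 0 < s.1 + x.2 / m - x.1 / l) :
    step l m s x = (s.1 + x.2 / m - x.1 / l, s.2 + x.1 / l) := by
  simp [step, max_eq_left h.le, h]

lemma step_of_nonpos {s x : ℝ × ℝ} (h : s.1 + x.2 / m - x.1 / l ≤ 0) :
    step l m s x = (0, 0) := by
  simp [step, max_eq_right h]

lemma limState_fst_nonneg {a : ℕ → ℝ × ℝ} (h : Tendsto (walk l m a) atTop atBot) :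
    0 ≤ (limState l m a).1 :=
  (walk_zero a).symm.le.trans (le_ciSup (bddAbove_of_tendsto_atBot h) 0)

/-- Apart from index 0, the walk is the shifted walk plus its first increment. If the best value
over positive indices is positive, the first maximizer moves by one; otherwise it is 0 and both
coordinates vanish. Taking the first maximizer matches the strict inequality in `step`. -/
lemma limState_eq_step {a : ℕ → ℝ × ℝ} (h : Tendsto (walk l m a) atTop atBot) :
    limState l m a = step l m (limState l m (drop 1 a)) (a 0) := by
  have h' := tendsto_walk_drop h 1
  set τ := firstMax (walk l m (drop 1 a)) with hτ
  have hsup : ⨆ k, walk l m (drop 1 a) k = walk l m (drop 1 a) τ := iSup_eq_firstMax h'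
  have hsucc : walk l m a (τ + 1)
      = (limState l m (drop 1 a)).1 + (a 0).2 / m - (a 0).1 / l := by
    rw [limState, walk_succ', hsup]; ring
  have hle : ∀ k, walk l m a (k + 1) ≤ walk l m a (τ + 1) := fun k => by
    rw [walk_succ', walk_succ']
    have := le_firstMax h' k
    linarith
  by_cases hpos : 0 < walk l m a (τ + 1)
  · have hmax : ∀ j, walk l m a j ≤ walk l m a (τ + 1) := by
      rintro (_ | j)
      · rw [walk_zero]; exact hpos.le
      · exact hle j
    have hfirst : firstMax (walk l m a) = τ + 1 := by
      refine le_antisymm (firstMax_le hmax) ?_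
      have hmem := le_firstMax h
      rcases hk : firstMax (walk l m a) with _ | k
      · rw [hk] at hmem
        have := hmem (τ + 1)
        rw [walk_zero] at this
        exact absurd hpos this.not_gt
      · rw [hk] at hmem
        refine Nat.succ_le_succ (firstMax_le fun j => ?_)
        have := hmem (j + 1)
        rw [walk_succ', walk_succ'] at this
        linarith
    rw [step_of_pos (hsucc ▸ hpos), ← hsucc, limState, iSup_eq_of_forall_le hmax, hfirst,
      Finset.sum_range_succ']
    simp [limState, drop, add_comm 1, hτ]
  · have hmax : ∀ j, walk l m a j ≤ walk l m a 0 := by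
      rintro (_ | j)
      · rfl
      · rw [walk_zero]; exact (hle j).trans (not_lt.1 hpos)
    have hfirst : firstMax (walk l m a) = 0 := Nat.le_zero.1 (firstMax_le hmax)
    rw [step_of_nonpos (hsucc ▸ not_lt.1 hpos), limState, iSup_eq_of_forall_le hmax, hfirst,
      walk_zero]
    simp

lemma runBack_limState {a : ℕ → ℝ × ℝ} (h : Tendsto (walk l m a) atTop atBot) (n : ℕ) :
    runBack l m n (limState l m (drop n a)) a = limState l m a := by
  induction n generalizing a with
  | zero => rw [drop_zero]; rfl
  | succ n ih =>
    have := ih (tendsto_walk_drop h 1)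
    rw [drop_drop, add_comm 1 n] at this
    rw [runBack, this, limState_eq_step h]

/-- As long as two trajectories with common inputs have not merged, the larger waiting time has
never been reset and follows the free walk. When it is reset, so is the smaller one, and both ages
restart at 0. Positivity is claimed only for `n ≠ 0` because the initial states are arbitrary. -/
lemma runBack_eq_or (n : ℕ) (z z' : ℝ × ℝ) (a : ℕ → ℝ × ℝ) :
    runBack l m n z a = runBack l m n z' a ∨
      (max (runBack l m n z a).1 (runBack l m n z' a).1 = max z.1 z'.1 + walk l m a n ∧
        (n ≠ 0 → 0 < max z.1 z'.1 + walk l m a n)) := by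
  induction n generalizing a with
  | zero => right; simp [runBack, walk]
  | succ n ih =>
    rcases ih (drop 1 a) with h | ⟨h, -⟩
    · left; rw [runBack, runBack, h]
    · have hw := walk_succ' (l := l) (m := m) a n
      set s := runBack l m n z (drop 1 a)
      set s' := runBack l m n z' (drop 1 a)
      have hmax : max (step l m s (a 0)).1 (step l m s' (a 0)).1
          = max (max z.1 z'.1 + walk l m a (n + 1)) 0 := by
        simp only [step]
        rw [hw, ← add_assoc, ← h]
        rcases le_total s.1 s'.1 with hs | hs
        · rw [max_eq_right hs, max_eq_right (max_le_max (by linarith) le_rfl)]; ring_nf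
        · rw [max_eq_left hs, max_eq_left (max_le_max (by linarith) le_rfl)]; ring_nf
      by_cases hpos : 0 < max z.1 z'.1 + walk l m a (n + 1)
      · exact Or.inr ⟨by rw [runBack, runBack, hmax, max_eq_left hpos.le], fun _ => hpos⟩
      · left
        rw [max_eq_right (not_lt.1 hpos)] at hmax
        have aux : ∀ t : ℝ × ℝ, (step l m t (a 0)).1 ≤ 0 → step l m t (a 0) = (0, 0) := by
          intro t ht
          have h0 : max (t.1 + (a 0).2 / m - (a 0).1 / l) 0 = 0 :=
            le_antisymm ht (le_max_right _ _)
          simp [step, h0]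
        rw [runBack, runBack, aux s (by rw [← hmax]; exact le_max_left _ _),
          aux s' (by rw [← hmax]; exact le_max_right _ _)]

lemma eventually_runBack_eq {a : ℕ → ℝ × ℝ} (h : Tendsto (walk l m a) atTop atBot) (z : ℝ × ℝ) :
    ∀ᶠ n in atTop, runBack l m n z a = limState l m a := by
  obtain ⟨N, hN⟩ := eventually_atTop.1 (h.eventually (eventually_lt_atBot 0))
  filter_upwards [h.eventually (eventually_lt_atBot (-z.1)), eventually_ge_atTop (max N 1)]
    with n hn hnN
  have hN' : N ≤ n := (le_max_left _ _).trans hnN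
  have h1 : n ≠ 0 := Nat.one_le_iff_ne_zero.1 ((le_max_right _ _).trans hnN)
  -- The comparison trajectory starts from the limit state of the remaining inputs and so ends at
  -- `limState l m a`.
  rcases runBack_eq_or (l := l) (m := m) n z (limState l m (drop n a)) a with h2 | ⟨-, h2⟩
  · rw [h2, runBack_limState h]
  · have h3 := h2 h1
    have h4 : (limState l m (drop n a)).1 + walk l m a n < 0 := by
      -- This sum is the maximum of the walk over indices at least `n`, which is negative beyond
      -- `N`.
      rw [limState, iSup_eq_firstMax (tendsto_walk_drop h n), add_comm, ← walk_add]
      exact hN _ (by omega)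
    rw [max_add] at h3
    have := max_lt (show z.1 + walk l m a n < 0 by linarith) h4
    exact absurd h3 this.not_gt

lemma step_fst_mono {s s' : ℝ × ℝ} (h : s.1 ≤ s'.1) (x : ℝ × ℝ) :
    (step l m s x).1 ≤ (step l m s' x).1 :=
  max_le_max (by linarith) le_rfl

lemma runBack_fst_mono (n : ℕ) {z z' : ℝ × ℝ} (h : z.1 ≤ z'.1) (a : ℕ → ℝ × ℝ) :
    (runBack l m n z a).1 ≤ (runBack l m n z' a).1 := by
  induction n generalizing a with
  | zero => exact h
  | succ n ih => exact step_fst_mono (ih _) _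

lemma run_fst_mono (n : ℕ) {z z' : ℝ × ℝ} (h : z.1 ≤ z'.1) (a : ℕ → ℝ × ℝ) :
    (run l m n z a).1 ≤ (run l m n z' a).1 := by
  induction n with
  | zero => exact h
  | succ n ih => exact step_fst_mono ih _

lemma run_fst_nonneg (n : ℕ) {z : ℝ × ℝ} (h : 0 ≤ z.1) (a : ℕ → ℝ × ℝ) :
    0 ≤ (run l m n z a).1 := by
  cases n with
  | zero => exact h
  | succ n => exact le_max_right _ _

lemma runBack_fst_nonneg (n : ℕ) {z : ℝ × ℝ} (h : 0 ≤ z.1) (a : ℕ → ℝ × ℝ) :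
    0 ≤ (runBack l m n z a).1 := by
  cases n with
  | zero => exact h
  | succ n => exact le_max_right _ _

lemma run_add (n k : ℕ) (z : ℝ × ℝ) (a : ℕ → ℝ × ℝ) :
    run l m (n + k) z a = run l m k (run l m n z a) (drop n a) := by
  induction k with
  | zero => rfl
  | succ k ih => rw [← add_assoc, run, ih]; rfl

lemma run_congr (n : ℕ) (z : ℝ × ℝ) {a b : ℕ → ℝ × ℝ} (h : ∀ i < n, a i = b i) :
    run l m n z a = run l m n z b := by
  induction n with
  | zero => rfl
  | succ n ih => rw [run, run, ih fun i hi => h i (by omega), h n (by omega)]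

variable (l m)

@[fun_prop]
lemma measurable_step : Measurable fun z : (ℝ × ℝ) × (ℝ × ℝ) => step l m z.1 z.2 := by
  unfold step
  have h : Measurable fun z : (ℝ × ℝ) × (ℝ × ℝ) => max (z.1.1 + z.2.2 / m - z.2.1 / l) 0 := by
    fun_prop
  exact h.prodMk (Measurable.ite (measurableSet_lt measurable_const h) (by fun_prop) (by fun_prop))

@[fun_prop]
lemma measurable_run (n : ℕ) :
    Measurable fun z : (ℝ × ℝ) × (ℕ → ℝ × ℝ) => run l m n z.1 z.2 := by
  induction n with
  | zero => exact measurable_fst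
  | succ n ih =>
    exact (measurable_step l m).comp (ih.prodMk ((measurable_pi_apply n).comp measurable_snd))

@[fun_prop]
lemma measurable_runBack (n : ℕ) :
    Measurable fun z : (ℝ × ℝ) × (ℕ → ℝ × ℝ) => runBack l m n z.1 z.2 := by
  induction n with
  | zero => exact measurable_fst
  | succ n ih =>
    exact (measurable_step l m).comp ((ih.comp (measurable_fst.prodMk
      ((measurable_drop 1).comp measurable_snd))).prodMk
        ((measurable_pi_apply 0).comp measurable_snd))

@[fun_prop]
lemma measurable_walk (k : ℕ) : Measurable fun a => walk l m a k := by
  unfold walk; fun_prop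

end Dynamics

/-! ### Existence and uniqueness of the stationary law. -/

section Stationary

variable (ν : Measure (ℝ × ℝ)) (l m : ℝ)

/-- The law of the state after one step from a state with law `π`. -/
noncomputable def pushStep (π : Measure (ℝ × ℝ)) : Measure (ℝ × ℝ) :=
  (π.prod ν).map fun z : (ℝ × ℝ) × (ℝ × ℝ) => step l m z.1 z.2

/-- The law of the maximum of the walk, together with the time until it is attained. -/
noncomputable def limLaw : Measure (ℝ × ℝ) := (iidLaw ν).map (limState l m)

variable [IsProbabilityMeasure ν]

instance (π : Measure (ℝ × ℝ)) [IsProbabilityMeasure π] :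
    IsProbabilityMeasure (pushStep ν l m π) :=
  Measure.isProbabilityMeasure_map (measurable_step l m).aemeasurable

lemma measurePreserving_runBack (n : ℕ) (π : Measure (ℝ × ℝ)) [IsProbabilityMeasure π] :
    MeasurePreserving (fun z => runBack l m n z.1 z.2) (π.prod (iidLaw ν))
      ((pushStep ν l m)^[n] π) := by
  refine ⟨measurable_runBack l m n, ?_⟩
  induction n with
  | zero => simp [runBack]
  | succ n ih =>
    have hP : IsProbabilityMeasure ((pushStep ν l m)^[n] π) := by
      rw [← ih]
      exact Measure.isProbabilityMeasure_map (measurable_runBack l m n).aemeasurable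
    have h1 : MeasurePreserving (fun a : ℕ → ℝ × ℝ => (a 0, drop 1 a)) (iidLaw ν)
        (ν.prod (iidLaw ν)) := ⟨by fun_prop, map_eval_zero_drop_one ν⟩
    have h2 := (MeasurePreserving.id π).prod ((Measure.measurePreserving_swap (μ := ν)
      (ν := iidLaw ν)).comp h1)
    have h3 := (measurePreserving_prodAssoc π (iidLaw ν) ν).symm.comp h2
    have h4 : MeasurePreserving (fun z => runBack l m n z.1 z.2) (π.prod (iidLaw ν))
      ((pushStep ν l m)^[n] π) := ⟨measurable_runBack l m n, ih⟩
    have h5 := (h4.prod (MeasurePreserving.id ν)).comp h3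
    rw [Function.iterate_succ_apply', pushStep, ← h5.map_eq,
      Measure.map_map (measurable_step l m) h5.measurable]
    rfl

lemma run_succ' (n : ℕ) (z : ℝ × ℝ) (a : ℕ → ℝ × ℝ) :
    run l m (n + 1) z a = run l m n (step l m z (a 0)) (drop 1 a) := by
  rw [add_comm, run_add]; rfl

lemma measurePreserving_run (n : ℕ) (π : Measure (ℝ × ℝ)) [IsProbabilityMeasure π] :
    MeasurePreserving (fun z => run l m n z.1 z.2) (π.prod (iidLaw ν))
      ((pushStep ν l m)^[n] π) := by
  refine ⟨measurable_run l m n, ?_⟩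
  induction n generalizing π with
  | zero => simp [run]
  | succ n ih =>
    have h1 : MeasurePreserving (fun a : ℕ → ℝ × ℝ => (a 0, drop 1 a)) (iidLaw ν)
        (ν.prod (iidLaw ν)) := ⟨by fun_prop, map_eval_zero_drop_one ν⟩
    have h2 := (measurePreserving_prodAssoc π ν (iidLaw ν)).symm.comp
      ((MeasurePreserving.id π).prod h1)
    have h3 : MeasurePreserving (fun z : (ℝ × ℝ) × (ℝ × ℝ) => step l m z.1 z.2) (π.prod ν)
      (pushStep ν l m π) := ⟨measurable_step l m, rfl⟩
    have h5 := (h3.prod (MeasurePreserving.id (iidLaw ν))).comp h2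
    rw [Function.iterate_succ_apply, ← ih, ← h5.map_eq,
      Measure.map_map (measurable_run l m n) h5.measurable]
    congr 1
    ext1 z
    exact run_succ' l m n z.1 z.2

/-- At a fixed time, i.i.d. inputs may be reversed. Almost sure convergence of the backward
iteration thereby gives convergence of expectations for the actual queue. -/
lemma map_run_eq_map_runBack (n : ℕ) (z : ℝ × ℝ) :
    (iidLaw ν).map (run l m n z) = (iidLaw ν).map (runBack l m n z) := by
  have h := (measurePreserving_run ν l m n (Measure.dirac z)).map_eq.trans
    (measurePreserving_runBack ν l m n (Measure.dirac z)).map_eq.symm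
  rwa [Measure.dirac_prod, Measure.map_map (measurable_run l m n) (by fun_prop),
    Measure.map_map (measurable_runBack l m n) (by fun_prop)] at h

variable {ν l m} (hdrift : ∀ᵐ a ∂(iidLaw ν), Tendsto (walk l m a) atTop atBot)
include hdrift

omit [IsProbabilityMeasure ν] in
-- An almost sure limit of the measurable backward iterates, so measurability of `firstMax` is never
-- examined directly.
lemma aemeasurable_limState : AEMeasurable (limState l m) (iidLaw ν) := by
  refine aemeasurable_of_tendsto_metrizable_ae atTop (f := fun n a => runBack l m n (0, 0) a)
    (fun n => ((measurable_runBack l m n).comp measurable_prodMk_left).aemeasurable) ?_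
  filter_upwards [hdrift] with a ha
  exact tendsto_nhds_of_eventually_eq (eventually_runBack_eq ha (0, 0))

lemma isProbabilityMeasure_limLaw : IsProbabilityMeasure (limLaw ν l m) :=
  Measure.isProbabilityMeasure_map (aemeasurable_limState hdrift)

lemma aemeasurable_limState_drop_one :
    AEMeasurable (fun a => (limState l m (drop 1 a), a 0)) (iidLaw ν) :=
  ((aemeasurable_limState hdrift).comp_quasiMeasurePreserving
    (measurePreserving_drop ν 1).quasiMeasurePreserving).prodMk (measurable_pi_apply 0).aemeasurable

lemma map_limState_drop_one :
    (iidLaw ν).map (fun a => (limState l m (drop 1 a), a 0)) = (limLaw ν l m).prod ν := by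
  have := isProbabilityMeasure_limLaw hdrift
  have hlim := aemeasurable_limState hdrift
  have h1 : MeasurePreserving (fun a : ℕ → ℝ × ℝ => (a 0, drop 1 a)) (iidLaw ν)
      (ν.prod (iidLaw ν)) := ⟨by fun_prop, map_eval_zero_drop_one ν⟩
  have h2 : MeasurePreserving (hlim.mk _) (iidLaw ν) (limLaw ν l m) :=
    ⟨hlim.measurable_mk, (Measure.map_congr hlim.ae_eq_mk).symm⟩
  have h3 := (h2.prod (MeasurePreserving.id ν)).comp (Measure.measurePreserving_swap.comp h1)
  rw [← h3.map_eq]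
  refine Measure.map_congr ?_
  filter_upwards [(measurePreserving_drop ν 1).quasiMeasurePreserving.ae hlim.ae_eq_mk] with a ha
  simp [← ha]

lemma pushStep_limLaw : pushStep ν l m (limLaw ν l m) = limLaw ν l m := by
  rw [pushStep, ← map_limState_drop_one hdrift, limLaw, AEMeasurable.map_map_of_aemeasurable
    (measurable_step l m).aemeasurable]
  · refine Measure.map_congr ?_
    filter_upwards [hdrift] with a ha
    exact (limState_eq_step ha).symm
  · exact aemeasurable_limState_drop_one hdrift

/-- Started from a stationary law independent of the inputs, the backward iterates all have law `π`,
while almost surely they are eventually equal to `limState`. -/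
lemma eq_limLaw_of_pushStep {π : Measure (ℝ × ℝ)} [IsProbabilityMeasure π]
    (hπ : pushStep ν l m π = π) : π = limLaw ν l m := by
  have hlim := aemeasurable_limState hdrift
  set Y := hlim.mk _ with hY
  have hYm : Measurable Y := hlim.measurable_mk
  have hev : ∀ᵐ z ∂(π.prod (iidLaw ν)), ∀ᶠ n in atTop, runBack l m n z.1 z.2 = Y z.2 := by
    filter_upwards [Measure.quasiMeasurePreserving_snd.ae hdrift,
      Measure.quasiMeasurePreserving_snd.ae hlim.ae_eq_mk] with z hz hz'
    rw [show Y z.2 = limState l m z.2 from hz'.symm]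
    exact eventually_runBack_eq hz z.1
  ext A hA
  have hlimA := tendsto_measure_of_ae_tendsto_indicator_of_isFiniteMeasure (μ := π.prod (iidLaw ν))
    atTop (A := (fun z => Y z.2) ⁻¹' A)
    (As := fun n => (fun z : (ℝ × ℝ) × (ℕ → ℝ × ℝ) => runBack l m n z.1 z.2) ⁻¹' A)
    ((hYm.comp measurable_snd) hA) (fun n => measurable_runBack l m n hA)
    (by
      filter_upwards [hev] with z hz
      filter_upwards [hz] with n hn
      simp [hn])
  have hconst : ∀ n, (π.prod (iidLaw ν))
      ((fun z : (ℝ × ℝ) × (ℕ → ℝ × ℝ) => runBack l m n z.1 z.2) ⁻¹' A) = π A := fun n => by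
    rw [(measurePreserving_runBack ν l m n π).measure_preimage hA.nullMeasurableSet,
      Function.iterate_fixed hπ]
  simp only [hconst] at hlimA
  have h2 := tendsto_nhds_unique tendsto_const_nhds hlimA
  rw [h2, limLaw, Measure.map_congr hlim.ae_eq_mk, Measure.map_apply hYm hA]
  exact (measurePreserving_snd (μ := π) (ν := iidLaw ν)).measure_preimage
    (hYm hA).nullMeasurableSet

end Stationary

section SteadyState

variable {νU νV : Measure ℝ} [IsProbabilityMeasure νU] [IsProbabilityMeasure νV] {l m : ℝ}
  (hdrift : ∀ᵐ a ∂(iidLaw (νU.prod νV)), Tendsto (walk l m a) atTop atBot)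
include hdrift

lemma isSteadyState_limLaw : IsSteadyState νU νV l m (limLaw (νU.prod νV) l m) :=
  ⟨isProbabilityMeasure_limLaw hdrift, pushStep_limLaw hdrift⟩

lemma IsSteadyState.eq_limLaw {π : Measure (ℝ × ℝ)} (h : IsSteadyState νU νV l m π) :
    π = limLaw (νU.prod νV) l m :=
  have := h.1
  eq_limLaw_of_pushStep hdrift h.2

lemma steadyState_eq : steadyState νU νV l m = limLaw (νU.prod νV) l m := by
  have h : ∃ π, IsSteadyState νU νV l m π := ⟨_, isSteadyState_limLaw hdrift⟩
  rw [steadyState, dif_pos h]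
  exact h.choose_spec.eq_limLaw hdrift

lemma meanWait_eq :
    meanWait νU νV l m = ∫ a, ⨆ k, walk l m a k ∂(iidLaw (νU.prod νV)) := by
  rw [meanWait, steadyState_eq hdrift, limLaw, integral_map (aemeasurable_limState hdrift)
    measurable_fst.aestronglyMeasurable]
  rfl

lemma meanAge_eq :
    meanAge νU νV l m = ∫ a, (limState l m a).2 ∂(iidLaw (νU.prod νV)) := by
  rw [meanAge, steadyState_eq hdrift, limLaw, integral_map (aemeasurable_limState hdrift)
    measurable_snd.aestronglyMeasurable]

end SteadyState

/-! ### Light tails: negative drift and integrability of the maximum. -/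

/-- Laws on `[0, ∞)` with unit mean and light tails. -/
structure IsPrimitivePair (νU νV : Measure ℝ) : Prop where
  nonneg_U : ∀ᵐ x ∂νU, 0 ≤ x
  nonneg_V : ∀ᵐ x ∂νV, 0 ≤ x
  mean_U : ∫ x, x ∂νU = 1
  mean_V : ∫ x, x ∂νV = 1
  exp_tail : ∃ η : ℝ, 0 < η ∧ Integrable (fun x => Real.exp (η * x)) νU ∧
    Integrable (fun x => Real.exp (η * x)) νV

lemma IsInput.isPrimitivePair {Ω : Type*} [MeasurableSpace Ω] {P : Measure Ω}
    {U V : ℕ → Ω → ℝ} (h : IsInput P U V) (ht : LightTailed P U V) :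
    IsPrimitivePair (P.map (U 0)) (P.map (V 0)) := by
  have hU := (h.measurable_U 0).aemeasurable (μ := P)
  have hV := (h.measurable_V 0).aemeasurable (μ := P)
  obtain ⟨η, hη, h1, h2⟩ := ht
  refine ⟨?_, ?_, ?_, ?_, η, hη, ?_, ?_⟩
  · rw [ae_map_iff hU measurableSet_Ici]; exact h.nonneg_U
  · rw [ae_map_iff hV measurableSet_Ici]; exact h.nonneg_V
  · rw [integral_map hU (by fun_prop)]; exact h.mean_U
  · rw [integral_map hV (by fun_prop)]; exact h.mean_V
  · rwa [integrable_map_measure (by fun_prop) hU]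
  · rwa [integrable_map_measure (by fun_prop) hV]

namespace IsPrimitivePair

variable {νU νV : Measure ℝ} [IsProbabilityMeasure νU] [IsProbabilityMeasure νV]
  (h : IsPrimitivePair νU νV)
include h

omit [IsProbabilityMeasure νU] [IsProbabilityMeasure νV] in
lemma integrable_U : Integrable (fun x => x) νU := by
  -- A non-integrable function has Bochner integral 0, which contradicts unit mean.
  by_contra hc
  have := h.mean_U
  rw [integral_undef hc] at this
  exact zero_ne_one this

omit [IsProbabilityMeasure νU] [IsProbabilityMeasure νV] in
lemma integrable_V : Integrable (fun x => x) νV := by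
  by_contra hc
  have := h.mean_V
  rw [integral_undef hc] at this
  exact zero_ne_one this

omit [IsProbabilityMeasure νU] [IsProbabilityMeasure νV] in
lemma ae_nonneg_prod : ∀ᵐ z ∂(νU.prod νV), 0 ≤ z.1 ∧ 0 ≤ z.2 :=
  (Measure.quasiMeasurePreserving_fst.ae h.nonneg_U).and
    (Measure.quasiMeasurePreserving_snd.ae h.nonneg_V)

lemma ae_nonneg : ∀ᵐ a ∂(iidLaw (νU.prod νV)), ∀ i, 0 ≤ (a i).1 ∧ 0 ≤ (a i).2 :=
  ae_all_iff.2 fun i =>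
    (measurePreserving_eval (νU.prod νV) i).quasiMeasurePreserving.ae h.ae_nonneg_prod

variable {l m : ℝ}

lemma zero_mem_interior (hl : 0 < l) (hm : 0 < m) :
    (0 : ℝ) ∈ interior (integrableExpSet (fun z : ℝ × ℝ => z.2 / m - z.1 / l) (νU.prod νV)) := by
  obtain ⟨η, hη, hU, hV⟩ := h.exp_tail
  rw [mem_interior_iff_mem_nhds, Metric.mem_nhds_iff]
  -- With this radius |t|/l and |t|/m are below η, so exp(ηv) dominates for t ≥ 0 and exp(ηu) for t
  -- ≤ 0.
  refine ⟨min (η * l) (η * m), by positivity, fun t ht => ?_⟩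
  rw [Metric.mem_ball, dist_zero_right, Real.norm_eq_abs, lt_min_iff, ← div_lt_iff₀ hl,
    ← div_lt_iff₀ hm] at ht
  refine Integrable.mono' ((hV.comp_snd νU).add (hU.comp_fst νV)) (by fun_prop) ?_
  filter_upwards [h.ae_nonneg_prod] with z hz
  rw [Real.norm_eq_abs, Real.abs_exp, Pi.add_apply]
  rcases le_total 0 t with h0 | h0
  · rw [abs_of_nonneg h0] at ht
    have h1 : t * (z.2 / m - z.1 / l) ≤ η * z.2 := by
      have e1 : t / m * z.2 ≤ η * z.2 := mul_le_mul_of_nonneg_right ht.2.le hz.2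
      have e2 : 0 ≤ t * (z.1 / l) := mul_nonneg h0 (div_nonneg hz.1 hl.le)
      have e3 : t * (z.2 / m - z.1 / l) = t / m * z.2 - t * (z.1 / l) := by ring
      linarith
    exact (Real.exp_le_exp.2 h1).trans (le_add_of_nonneg_right (Real.exp_pos _).le)
  · rw [abs_of_nonpos h0] at ht
    have h1 : t * (z.2 / m - z.1 / l) ≤ η * z.1 := by
      have e1 : -t / l * z.1 ≤ η * z.1 := mul_le_mul_of_nonneg_right ht.1.le hz.1
      have e2 : 0 ≤ -t * (z.2 / m) := mul_nonneg (by linarith) (div_nonneg hz.2 hm.le)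
      have e3 : t * (z.2 / m - z.1 / l) = -t / l * z.1 - -t * (z.2 / m) := by ring
      linarith
    exact (Real.exp_le_exp.2 h1).trans (le_add_of_nonneg_left (Real.exp_pos _).le)

lemma integral_increment :
    ∫ z : ℝ × ℝ, (z.2 / m - z.1 / l) ∂(νU.prod νV) = 1 / m - 1 / l := by
  rw [integral_sub ((h.integrable_V.comp_snd νU).div_const m)
    ((h.integrable_U.comp_fst νV).div_const l), integral_div, integral_div,
    integral_fun_snd (fun x : ℝ => x), integral_fun_fst (fun x : ℝ => x), h.mean_U, h.mean_V]
  simp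

/-- The moment generating function is 1 at 0 with derivative 1/m - 1/l < 0 there. -/
lemma exists_mgf_lt_one (hl : 0 < l) (hlm : l < m) :
    ∃ θ, 0 < θ ∧ θ ∈ integrableExpSet (fun z : ℝ × ℝ => z.2 / m - z.1 / l) (νU.prod νV) ∧
      mgf (fun z : ℝ × ℝ => z.2 / m - z.1 / l) (νU.prod νV) θ < 1 := by
  have hint := h.zero_mem_interior hl (hl.trans hlm)
  have hd := hasDerivAt_mgf hint
  simp only [zero_mul, Real.exp_zero, mul_one] at hd
  rw [h.integral_increment] at hd
  have hneg : 1 / m - 1 / l < 0 := sub_neg.2 (one_div_lt_one_div_of_lt hl hlm)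
  have h1 := (hasDerivAt_iff_tendsto_slope.1 hd).mono_left
    (nhdsWithin_mono 0 (show Set.Ioi (0 : ℝ) ⊆ {0}ᶜ from fun x hx => ne_of_gt hx))
  have h2 := h1.eventually (eventually_lt_nhds hneg)
  have h3 : ∀ᶠ t in 𝓝[>] (0 : ℝ), t ∈ integrableExpSet _ _ :=
    nhdsWithin_le_nhds (mem_interior_iff_mem_nhds.1 hint)
  obtain ⟨θ, ⟨h4, h5⟩, h6⟩ := ((h2.and h3).and self_mem_nhdsWithin).exists
  have h6' : 0 < θ := h6
  refine ⟨θ, h6, h5, ?_⟩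
  rw [slope_def_field, mgf_zero, sub_zero, div_lt_iff₀ h6', zero_mul] at h4
  linarith

omit h in
lemma lintegral_exp_walk {θ : ℝ}
    (hθ : θ ∈ integrableExpSet (fun z : ℝ × ℝ => z.2 / m - z.1 / l) (νU.prod νV)) (k : ℕ) :
    ∫⁻ a, ENNReal.ofReal (Real.exp (θ * walk l m a k)) ∂(iidLaw (νU.prod νV))
      = ENNReal.ofReal (mgf (fun z : ℝ × ℝ => z.2 / m - z.1 / l) (νU.prod νV) θ) ^ k := by
  set Z : ℝ × ℝ → ℝ := fun z => z.2 / m - z.1 / l with hZ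
  have hZm : Measurable Z := by fun_prop
  have hind : iIndepFun (fun (i : ℕ) (a : ℕ → ℝ × ℝ) => Z (a i)) (iidLaw (νU.prod νV)) :=
    iIndepFun_infinitePi (P := fun _ : ℕ => νU.prod νV) (X := fun _ => Z) (fun _ => hZm)
  have hm : ∀ i : ℕ, Measurable fun a : ℕ → ℝ × ℝ => Z (a i) := fun i =>
    hZm.comp (measurable_pi_apply i)
  have hmp := fun i => measurePreserving_eval (νU.prod νV) i
  have hint : ∀ i ∈ Finset.range k, Integrable (fun a : ℕ → ℝ × ℝ => Real.exp (θ * Z (a i)))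
      (iidLaw (νU.prod νV)) := fun i _ => (hmp i).integrable_comp_of_integrable hθ
  have h1 := hind.mgf_sum hm (t := θ) (Finset.range k)
  have h2 : ∀ i, mgf (fun a : ℕ → ℝ × ℝ => Z (a i)) (iidLaw (νU.prod νV)) θ
      = mgf Z (νU.prod νV) θ := fun i => by
    conv_rhs => rw [← (hmp i).map_eq]
    rw [mgf, mgf, integral_map (hmp i).measurable.aemeasurable (by fun_prop)]
  simp only [h2, Finset.prod_const, Finset.card_range] at h1
  have h3 := hind.integrable_exp_mul_sum hm hint
  rw [← ENNReal.ofReal_pow mgf_nonneg, ← h1, mgf, ofReal_integral_eq_lintegral_ofReal h3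
    (ae_of_all _ fun _ => (Real.exp_pos _).le)]
  simp [walk, hZ]

/-- The expectations form a geometric series. This one bound gives both the divergence of the walk
to -∞ and the integrability of its maximum. -/
lemma exists_lintegral_tsum_exp_walk_lt_top (hl : 0 < l) (hlm : l < m) :
    ∃ θ, 0 < θ ∧ ∫⁻ a, ∑' k, ENNReal.ofReal (Real.exp (θ * walk l m a k))
      ∂(iidLaw (νU.prod νV)) < ∞ := by
  obtain ⟨θ, h0, h1, h2⟩ := h.exists_mgf_lt_one hl hlm
  refine ⟨θ, h0, ?_⟩
  rw [lintegral_tsum fun k => by fun_prop]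
  simp only [lintegral_exp_walk h1]
  rw [ENNReal.tsum_geometric, ENNReal.inv_lt_top, tsub_pos_iff_lt, ENNReal.ofReal_lt_one]
  exact h2

lemma ae_tendsto_walk (hl : 0 < l) (hlm : l < m) :
    ∀ᵐ a ∂(iidLaw (νU.prod νV)), Tendsto (walk l m a) atTop atBot := by
  obtain ⟨θ, h0, h1⟩ := h.exists_lintegral_tsum_exp_walk_lt_top hl hlm
  filter_upwards [ae_lt_top (by fun_prop) h1.ne] with a ha
  have h2 := ENNReal.tendsto_cofinite_zero_of_tsum_ne_top ha.ne
  rw [Nat.cofinite_eq_atTop, ← ENNReal.tendsto_toReal_zero_iff fun _ => ENNReal.ofReal_ne_top]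
    at h2
  simp only [ENNReal.toReal_ofReal (Real.exp_pos _).le] at h2
  exact (tendsto_const_mul_atBot_of_pos h0).1 (Real.tendsto_exp_comp_nhds_zero.1 h2)

lemma integrable_iSup_walk (hl : 0 < l) (hlm : l < m) :
    Integrable (fun a => ⨆ k, walk l m a k) (iidLaw (νU.prod νV)) := by
  obtain ⟨θ, h0, h1⟩ := h.exists_lintegral_tsum_exp_walk_lt_top hl hlm
  have hmeas : Measurable fun a => ∑' k, ENNReal.ofReal (Real.exp (θ * walk l m a k)) := by
    fun_prop
  have hint := integrable_toReal_of_lintegral_ne_top hmeas.aemeasurable h1.ne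
  refine Integrable.mono' (hint.const_mul (1 / θ)) (Measurable.aestronglyMeasurable
    (Measurable.iSup fun k => measurable_walk l m k)) ?_
  filter_upwards [ae_lt_top hmeas h1.ne, h.ae_tendsto_walk hl hlm] with a ha hlim
  rw [Real.norm_eq_abs, abs_of_nonneg (a := ⨆ k, walk l m a k) (limState_fst_nonneg hlim)]
  refine ciSup_le fun k => ?_
  have h2 : Real.exp (θ * walk l m a k)
      ≤ (∑' k, ENNReal.ofReal (Real.exp (θ * walk l m a k))).toReal := by
    rw [← ENNReal.ofReal_le_iff_le_toReal ha.ne]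
    exact ENNReal.le_tsum k
  -- Each θS_k is at most exp(θS_k), hence at most the integrable series.
  have h3 := Real.add_one_le_exp (θ * walk l m a k)
  rw [one_div, inv_mul_eq_div, le_div_iff₀ h0]
  linarith

end IsPrimitivePair

/-! ### Upper envelopes of lines and their one-sided derivatives. -/

section Envelope

/-- The upper envelope of the lines `s ↦ x k - s * y k`. -/
noncomputable def envelope (x y : ℕ → ℝ) (s : ℝ) : ℝ := ⨆ k, (x k - s * y k)

/-- Lines starting at the origin, with decreasing slopes, whose values at `s₀` tend to `-∞`. -/
structure IsLineFamily (x y : ℕ → ℝ) (s₀ : ℝ) : Prop where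
  x_zero : x 0 = 0
  y_zero : y 0 = 0
  mono : Monotone y
  tendsto : Tendsto (fun k => x k - s₀ * y k) atTop atBot

namespace IsLineFamily

variable {x y : ℕ → ℝ} {s₀ s : ℝ} (h : IsLineFamily x y s₀)
include h

lemma y_nonneg (k : ℕ) : 0 ≤ y k := h.y_zero ▸ h.mono k.zero_le

lemma of_le (hs : s₀ ≤ s) : IsLineFamily x y s :=
  ⟨h.x_zero, h.y_zero, h.mono, tendsto_atBot_mono
    (fun k => sub_le_sub_left (mul_le_mul_of_nonneg_right hs (h.y_nonneg k)) _) h.tendsto⟩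

lemma le_envelope (k : ℕ) : x k - s₀ * y k ≤ envelope x y s₀ :=
  le_ciSup (bddAbove_of_tendsto_atBot h.tendsto) k

lemma envelope_eq : envelope x y s₀
    = x (firstMax fun k => x k - s₀ * y k) - s₀ * y (firstMax fun k => x k - s₀ * y k) :=
  iSup_eq_firstMax h.tendsto

lemma envelope_nonneg : 0 ≤ envelope x y s₀ := by
  simpa [h.x_zero, h.y_zero] using h.le_envelope 0

lemma envelope_le (hs : s₀ ≤ s) : envelope x y s ≤ envelope x y s₀ :=
  ciSup_le fun k =>
    (sub_le_sub_left (mul_le_mul_of_nonneg_right hs (h.y_nonneg k)) _).trans (h.le_envelope k)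

/-- The maximizing line at `s` is nonnegative there and below the envelope at `s₀`, so it drops by
at most `envelope x y s₀` over a length `s - s₀`. -/
lemma y_firstMax_le (hs : s₀ < s) :
    y (firstMax fun k => x k - s * y k) ≤ envelope x y s₀ / (s - s₀) := by
  have h' := h.of_le hs.le
  rw [le_div_iff₀ (sub_pos.2 hs)]
  have h1 := h'.envelope_nonneg
  rw [h'.envelope_eq] at h1
  have h2 := h.le_envelope (firstMax fun k => x k - s * y k)
  linarith

lemma abs_envelope_sub_le {s₁ t : ℝ} (h₁ : s₀ < s₁) (hs : s₁ ≤ s) (ht : s₁ ≤ t) :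
    |envelope x y t - envelope x y s| ≤ envelope x y s₀ / (s₁ - s₀) * |t - s| := by
  wlog hst : s ≤ t generalizing s t
  · rw [abs_sub_comm, abs_sub_comm t]
    exact this ht hs (le_of_not_ge hst)
  have h' := h.of_le (h₁.le.trans hs)
  have h1 := h'.envelope_le hst
  have h2 := (h'.of_le hst).le_envelope (firstMax fun k => x k - s * y k)
  have h3 := h'.envelope_eq
  have h4 := h.y_firstMax_le (h₁.trans_le hs)
  have h5 : envelope x y s₀ / (s - s₀) ≤ envelope x y s₀ / (s₁ - s₀) :=
    div_le_div_of_nonneg_left h.envelope_nonneg (sub_pos.2 h₁) (by linarith)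
  have h6 := mul_le_mul_of_nonneg_right (h4.trans h5) (sub_nonneg.2 hst)
  rw [abs_of_nonpos (by linarith), abs_of_nonneg (sub_nonneg.2 hst)]
  linarith

/-- Lines beyond some index are already negative at `s₀`, hence never maximal to its right. Of the
finitely many others, those not maximal at `s` stay strictly below near `s`. -/
lemma eventually_exists_envelope_eq (hs : s₀ < s) :
    ∀ᶠ t in 𝓝 s, ∃ k, (∀ j, x j - s * y j ≤ x k - s * y k) ∧
      envelope x y t = x k - t * y k := by
  have h' := h.of_le hs.le
  obtain ⟨N, hN⟩ := eventually_atTop.1 (h.tendsto.eventually (eventually_lt_atBot 0))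
  set τ := firstMax fun k => x k - s * y k
  have hτ : ∀ j, x j - s * y j ≤ x τ - s * y τ := le_firstMax h'.tendsto
  have h1 : ∀ᶠ t in 𝓝 s, ∀ k ∈ Finset.range N,
      (∀ j, x j - s * y j ≤ x k - s * y k) ∨ x k - t * y k < x τ - t * y τ := by
    rw [Finset.eventually_all]
    intro k _
    by_cases hk : x k - s * y k < x τ - s * y τ
    · have hc : ContinuousAt (fun t => x k - t * y k) s := by fun_prop
      have hc' : ContinuousAt (fun t => x τ - t * y τ) s := by fun_prop
      filter_upwards [hc.eventually_lt hc' hk] with t ht using Or.inr ht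
    · exact Eventually.of_forall fun t => Or.inl fun j => (hτ j).trans (not_lt.1 hk)
  filter_upwards [h1, eventually_gt_nhds hs] with t ht hst
  have ht' := h.of_le hst.le
  refine ⟨firstMax fun k => x k - t * y k, ?_, ht'.envelope_eq⟩
  set k := firstMax fun k => x k - t * y k
  have hk : ∀ j, x j - t * y j ≤ x k - t * y k := le_firstMax ht'.tendsto
  have hkN : k < N := by
    by_contra hc
    have h2 := hN k (not_lt.1 hc)
    have h3 := hk 0
    rw [h.x_zero, h.y_zero] at h3
    have h4 := mul_le_mul_of_nonneg_right hst.le (h.y_nonneg k)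
    linarith
  rcases ht k (Finset.mem_range.2 hkN) with h2 | h2
  · exact h2
  · exact absurd h2 (hk τ).not_gt

/-- Near `s` only lines maximal at `s` matter. If line τ dominates these on `S`, the envelope
coincides there with line τ. -/
lemma hasDerivWithinAt_of_eventually {S : Set ℝ} (hs : s₀ < s)
    (hS : ∀ᶠ t in 𝓝[S] s, ∀ k, (∀ j, x j - s * y j ≤ x k - s * y k) →
      (t - s) * y (firstMax fun k => x k - s * y k) ≤ (t - s) * y k) :
    HasDerivWithinAt (envelope x y) (-y (firstMax fun k => x k - s * y k)) S s := by
  have h' := h.of_le hs.le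
  set τ := firstMax fun k => x k - s * y k
  have hlin : HasDerivWithinAt (fun t => envelope x y s + (t - s) * (-y τ)) (-y τ) S s := by
    simpa using ((((hasDerivAt_id s).sub_const s).mul_const (-y τ)).const_add
      (envelope x y s)).hasDerivWithinAt
  refine hlin.congr_of_eventuallyEq ?_ (by simp)
  filter_upwards [hS, nhdsWithin_le_nhds (h.eventually_exists_envelope_eq hs),
    nhdsWithin_le_nhds (eventually_gt_nhds hs)] with t ht ht' hst
  obtain ⟨k, hk, hkt⟩ := ht'
  have h1 := ht k hk
  have h2 : envelope x y s = x k - s * y k := iSup_eq_of_forall_le hk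
  have h3 : envelope x y s = x τ - s * y τ := h'.envelope_eq
  have h4 : x τ - t * y τ ≤ envelope x y t := (h.of_le (le_of_lt hst)).le_envelope τ
  linarith

/-- Among the lines maximal at `s`, the first has the smallest `y` and so lies on top to the right
of `s`. -/
lemma hasDerivWithinAt_Ici (hs : s₀ < s) :
    HasDerivWithinAt (envelope x y) (-y (firstMax fun k => x k - s * y k)) (Set.Ici s) s := by
  refine h.hasDerivWithinAt_of_eventually hs ?_
  filter_upwards [self_mem_nhdsWithin] with t ht k hk
  exact mul_le_mul_of_nonneg_left (h.mono (firstMax_le hk)) (sub_nonneg.2 ht)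

lemma hasDerivWithinAt_univ (hs : s₀ < s)
    (hy : ∀ k, (∀ j, x j - s * y j ≤ x k - s * y k) →
      y k = y (firstMax fun k => x k - s * y k)) :
    HasDerivWithinAt (envelope x y) (-y (firstMax fun k => x k - s * y k)) Set.univ s :=
  h.hasDerivWithinAt_of_eventually hs (Eventually.of_forall fun t k hk => by rw [hy k hk])

end IsLineFamily

lemma hasDerivWithinAt_integral_of_dominated_lip {A : Type*} [MeasurableSpace A] {Q : Measure A}
    {F : ℝ → A → ℝ} {F' bound : A → ℝ} {S : Set ℝ} {s : ℝ}
    (hF : ∀ᶠ t in 𝓝[S] s, Integrable (F t) Q) (hFs : Integrable (F s) Q)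
    (hlip : ∀ᶠ t in 𝓝[S] s, ∀ᵐ a ∂Q, |F t a - F s a| ≤ bound a * |t - s|)
    (hbound : Integrable bound Q)
    (hdiff : ∀ᵐ a ∂Q, HasDerivWithinAt (fun t => F t a) (F' a) S s) :
    HasDerivWithinAt (fun t => ∫ a, F t a ∂Q) (∫ a, F' a ∂Q) S s := by
  rw [hasDerivWithinAt_iff_tendsto_slope]
  have hle : 𝓝[S \ {s}] s ≤ 𝓝[S] s := nhdsWithin_mono s Set.sdiff_subset
  have hslope : ∀ᶠ t in 𝓝[S \ {s}] s,
      ∫ a, slope (fun t => F t a) s t ∂Q = slope (fun t => ∫ a, F t a ∂Q) s t := by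
    filter_upwards [hF.filter_mono hle] with t ht
    simp only [slope_def_field]
    rw [integral_div, integral_sub ht hFs]
  refine Tendsto.congr' hslope (tendsto_integral_filter_of_dominated_convergence bound ?_ ?_
    hbound ?_)
  · filter_upwards [hF.filter_mono hle] with t ht
    simp only [slope_def_field]
    exact ((ht.sub hFs).div_const _).aestronglyMeasurable
  · filter_upwards [hlip.filter_mono hle, self_mem_nhdsWithin] with t ht hts
    filter_upwards [ht] with a ha
    have hne : 0 < |t - s| := abs_pos.2 (sub_ne_zero.2 hts.2)
    rw [slope_def_field, Real.norm_eq_abs, abs_div, div_le_iff₀ hne]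
    exact ha
  · filter_upwards [hdiff] with a ha
    exact hasDerivWithinAt_iff_tendsto_slope.1 ha

section Random

variable {A : Type*} [MeasurableSpace A] {Q : Measure A} {x y : A → ℕ → ℝ} {s₀ s : ℝ}
  (hx : ∀ k, Measurable fun a => x a k) (hy : ∀ k, Measurable fun a => y a k)
  (hfam : ∀ᵐ a ∂Q, IsLineFamily (x a) (y a) s₀)
  (hint : Integrable (fun a => envelope (x a) (y a) s₀) Q)
include hx hy hfam hint

lemma integrable_envelope (hs : s₀ ≤ s) : Integrable (fun a => envelope (x a) (y a) s) Q := by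
  refine hint.mono' (Measurable.aestronglyMeasurable
    (Measurable.iSup fun k => (hx k).sub ((hy k).const_mul s))) ?_
  filter_upwards [hfam] with a ha
  rw [Real.norm_eq_abs, abs_of_nonneg (ha.of_le hs).envelope_nonneg]
  exact ha.envelope_le hs

lemma hasDerivWithinAt_integral_envelope {S : Set ℝ} (hs : s₀ < s)
    (hdiff : ∀ᵐ a ∂Q, HasDerivWithinAt (envelope (x a) (y a))
      (-y a (firstMax fun k => x a k - s * y a k)) S s) :
    HasDerivWithinAt (fun t => ∫ a, envelope (x a) (y a) t ∂Q)
      (-∫ a, y a (firstMax fun k => x a k - s * y a k) ∂Q) S s := by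
  rw [← integral_neg]
  -- The Lipschitz bound blows up at `s₀`; restricting to parameters beyond the midpoint makes it
  -- uniform.
  have hmid : (s₀ + s) / 2 < s := by linarith
  have hmid' : s₀ < (s₀ + s) / 2 := by linarith
  refine hasDerivWithinAt_integral_of_dominated_lip (F := fun t a => envelope (x a) (y a) t)
    (bound := fun a => envelope (x a) (y a) s₀ / ((s₀ + s) / 2 - s₀)) ?_
    (integrable_envelope hx hy hfam hint hs.le) ?_ (hint.div_const _) hdiff
  · filter_upwards [nhdsWithin_le_nhds (eventually_gt_nhds hs)] with t ht
    exact integrable_envelope hx hy hfam hint (le_of_lt ht)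
  · filter_upwards [nhdsWithin_le_nhds (eventually_gt_nhds hmid)] with t ht
    filter_upwards [hfam] with a ha
    exact ha.abs_envelope_sub_le hmid' hmid.le (le_of_lt ht)

end Random

end Envelope

/-- Write |X - c| = (X - c) + 2(c - X)⁺. The means of the first term vanish in the limit, and the
second is bounded by 2c and tends to 0 almost surely, so the convergence even holds in L¹. -/
lemma tendstoInMeasure_const_of_tendsto_integral {A : Type*} [MeasurableSpace A] {Q : Measure A}
    [IsProbabilityMeasure Q] {X : ℕ → A → ℝ} {c : ℝ} (hc : 0 ≤ c)
    (hint : ∀ n, Integrable (X n) Q) (hnn : ∀ᵐ a ∂Q, ∀ n, 0 ≤ X n a)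
    (hE : Tendsto (fun n => ∫ a, X n a ∂Q) atTop (𝓝 c))
    (hlow : ∀ ε > 0, ∀ᵐ a ∂Q, ∀ᶠ n in atTop, c - ε ≤ X n a) :
    TendstoInMeasure Q X atTop (fun _ => c) := by
  have hG : Tendsto (fun n => ∫ a, max (c - X n a) 0 ∂Q) atTop (𝓝 (∫ _, (0 : ℝ) ∂Q)) := by
    refine tendsto_integral_of_dominated_convergence (fun _ => c) (fun n => ?_)
      (integrable_const c) (fun n => ?_) ?_
    · exact (((integrable_const c).sub (hint n)).pos_part).aestronglyMeasurable
    · filter_upwards [hnn] with a ha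
      rw [Real.norm_eq_abs, abs_of_nonneg (le_max_right _ _)]
      exact max_le (by linarith [ha n]) hc
    · have hall : ∀ᵐ a ∂Q, ∀ k : ℕ, ∀ᶠ n in atTop, c - 1 / ((k : ℝ) + 1) ≤ X n a :=
        ae_all_iff.2 fun k => hlow _ (by positivity)
      filter_upwards [hall] with a ha
      rw [Metric.tendsto_atTop']
      intro ε hε
      obtain ⟨k, hk⟩ := exists_nat_one_div_lt hε
      obtain ⟨N, hN⟩ := eventually_atTop.1 (ha k)
      refine ⟨N, fun n hn => ?_⟩
      rw [Real.dist_eq, sub_zero, abs_of_nonneg (le_max_right _ _)]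
      exact max_lt (by linarith [hN n hn.le]) hε
  rw [integral_zero] at hG
  have habs : ∀ n, ∫ a, ‖X n a - c‖ ∂Q
      = (∫ a, X n a ∂Q - c) + 2 * ∫ a, max (c - X n a) 0 ∂Q := fun n => by
    have h1 : ∀ a, ‖X n a - c‖ = (X n a - c) + 2 * max (c - X n a) 0 := fun a => by
      rw [Real.norm_eq_abs]
      rcases le_total (X n a) c with h | h
      · rw [abs_of_nonpos (by linarith), max_eq_left (by linarith)]; ring
      · rw [abs_of_nonneg (by linarith), max_eq_right (by linarith)]; ring
    have h2 : Integrable (fun a => X n a - c) Q := (hint n).sub (integrable_const c)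
    have h3 : Integrable (fun a => max (c - X n a) 0) Q :=
      ((integrable_const c).sub (hint n)).pos_part
    simp only [h1]
    rw [integral_add h2 (h3.const_mul 2), integral_const_mul,
      integral_sub (hint n) (integrable_const c)]
    simp
  have hL1 : Tendsto (fun n => ∫ a, ‖X n a - c‖ ∂Q) atTop (𝓝 0) := by
    simp only [habs]
    simpa using (hE.sub_const c).add (hG.const_mul 2)
  refine tendstoInMeasure_of_tendsto_eLpNorm one_ne_zero
    (fun n => (hint n).aestronglyMeasurable) aestronglyMeasurable_const ?_
  have h2 : ∀ n, eLpNorm (X n - fun _ => c) 1 Q = ENNReal.ofReal (∫ a, ‖X n a - c‖ ∂Q) :=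
    fun n => by
      rw [eLpNorm_one_eq_lintegral_enorm, ← ofReal_integral_norm_eq_lintegral_enorm
        ((hint n).sub (integrable_const c))]
      rfl
  simp only [h2]
  simpa using ENNReal.tendsto_ofReal hL1

/-! ### Sojourn times and their averages. -/

section Sojourn

variable (l m : ℝ)

/-- The time customer `i` spends in the system, when customer `0` finds the system empty. -/
noncomputable def sojourn (i : ℕ) (a : ℕ → ℝ × ℝ) : ℝ := (run l m i (0, 0) a).1 + (a i).2 / m

/-- The total time the first `n` customers spend in the system. -/
noncomputable def totalSojourn (n : ℕ) (a : ℕ → ℝ × ℝ) : ℝ :=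
  ∑ i ∈ Finset.range n, sojourn l m i a

@[fun_prop]
lemma measurable_sojourn (i : ℕ) : Measurable (sojourn l m i) := by
  have h : Measurable fun a => run l m i (0, 0) a :=
    (measurable_run l m i).comp measurable_prodMk_left
  unfold sojourn
  fun_prop

@[fun_prop]
lemma measurable_totalSojourn (n : ℕ) : Measurable (totalSojourn l m n) := by
  unfold totalSojourn; fun_prop

variable {l m}

lemma sojourn_nonneg (hm : 0 < m) (i : ℕ) {a : ℕ → ℝ × ℝ} (ha : 0 ≤ (a i).2) :
    0 ≤ sojourn l m i a :=
  add_nonneg (run_fst_nonneg i le_rfl a) (div_nonneg ha hm.le)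

/-- Forgetting the first `n` customers restarts the queue empty, and waiting times are monotone in
the initial wait. Superadditivity of total sojourn times follows. -/
lemma sojourn_drop_le (n i : ℕ) (a : ℕ → ℝ × ℝ) :
    sojourn l m i (drop n a) ≤ sojourn l m (n + i) a := by
  rw [sojourn, sojourn, run_add]
  exact add_le_add (run_fst_mono i (run_fst_nonneg n le_rfl a) _) le_rfl

lemma totalSojourn_add_le (n k : ℕ) (a : ℕ → ℝ × ℝ) :
    totalSojourn l m n a + totalSojourn l m k (drop n a) ≤ totalSojourn l m (n + k) a := by
  rw [totalSojourn, totalSojourn, totalSojourn, Finset.sum_range_add]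
  exact add_le_add le_rfl (Finset.sum_le_sum fun i _ => sojourn_drop_le n i a)

lemma sum_totalSojourn_drop_le (K j : ℕ) (a : ℕ → ℝ × ℝ) :
    ∑ i ∈ Finset.range j, totalSojourn l m K (drop (K * i) a) ≤ totalSojourn l m (K * j) a := by
  induction j with
  | zero => simp [totalSojourn]
  | succ j ih =>
    rw [Finset.sum_range_succ, Nat.mul_succ]
    exact (add_le_add ih le_rfl).trans (totalSojourn_add_le _ _ a)

lemma totalSojourn_mono (hm : 0 < m) {a : ℕ → ℝ × ℝ} (ha : ∀ i, 0 ≤ (a i).2) :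
    Monotone fun n => totalSojourn l m n a :=
  monotone_nat_of_le_succ fun n => by
    rw [totalSojourn, totalSojourn, Finset.sum_range_succ]
    exact le_add_of_nonneg_right (sojourn_nonneg hm n (ha n))

lemma dependsOn_totalSojourn_drop (K n : ℕ) :
    DependsOn (fun a => totalSojourn l m K (drop n a)) (Finset.Ico n (n + K) : Finset ℕ) := by
  intro a b hab
  refine Finset.sum_congr rfl fun i hi => ?_
  have hi' := Finset.mem_range.1 hi
  have h : ∀ j < K, drop n a j = drop n b j := fun j hj => hab _ (by simp; omega)
  rw [sojourn, sojourn, run_congr i _ fun j hj => h j (by omega), h i hi']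

end Sojourn

namespace IsPrimitivePair

variable {νU νV : Measure ℝ} [IsProbabilityMeasure νU] [IsProbabilityMeasure νV]
  (h : IsPrimitivePair νU νV) {l m : ℝ} (hl : 0 < l) (hlm : l < m)
include h

lemma tendsto_arrival_div :
    ∀ᵐ a ∂(iidLaw (νU.prod νV)),
      Tendsto (fun n : ℕ => (∑ i ∈ Finset.range n, (a i).1 / l) / n) atTop (𝓝 (1 / l)) := by
  have hmp := fun i => measurePreserving_eval (νU.prod νV) i
  have hind : iIndepFun (fun (i : ℕ) (a : ℕ → ℝ × ℝ) => (a i).1 / l) (iidLaw (νU.prod νV)) :=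
    iIndepFun_infinitePi (P := fun _ : ℕ => νU.prod νV) (X := fun _ z => z.1 / l)
      (fun _ => by fun_prop)
  have hint : Integrable (fun z : ℝ × ℝ => z.1 / l) (νU.prod νV) :=
    (h.integrable_U.comp_fst νV).div_const l
  have hid : ∀ i, IdentDistrib (fun a : ℕ → ℝ × ℝ => (a i).1 / l) (fun a => (a 0).1 / l)
      (iidLaw (νU.prod νV)) (iidLaw (νU.prod νV)) := fun i => by
    have : IdentDistrib (fun a : ℕ → ℝ × ℝ => a i) (fun a => a 0)
        (iidLaw (νU.prod νV)) (iidLaw (νU.prod νV)) :=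
      ⟨(hmp i).measurable.aemeasurable, (hmp 0).measurable.aemeasurable,
        (hmp i).map_eq.trans (hmp 0).map_eq.symm⟩
    exact this.comp (u := fun z : ℝ × ℝ => z.1 / l) (by fun_prop)
  have hlln := strong_law_ae_real (fun (i : ℕ) (a : ℕ → ℝ × ℝ) => (a i).1 / l)
    ((hmp 0).integrable_comp_of_integrable hint) (fun i j hij => hind.indepFun hij) hid
  have hval : ∫ a, (a 0).1 / l ∂(iidLaw (νU.prod νV)) = 1 / l := by
    have h1 : ∫ z, z.1 / l ∂((iidLaw (νU.prod νV)).map fun a : ℕ → ℝ × ℝ => a 0)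
        = ∫ a, (a 0).1 / l ∂(iidLaw (νU.prod νV)) :=
      integral_map (hmp 0).measurable.aemeasurable (by fun_prop)
    rw [← h1, (hmp 0).map_eq, integral_div, integral_fun_fst (fun x : ℝ => x), h.mean_U]
    simp
  rwa [hval] at hlln

lemma integral_service (n : ℕ) :
    Integrable (fun a : ℕ → ℝ × ℝ => (a n).2 / m) (iidLaw (νU.prod νV)) ∧
      ∫ a, (a n).2 / m ∂(iidLaw (νU.prod νV)) = 1 / m := by
  have hmp := measurePreserving_eval (νU.prod νV) n
  have hint : Integrable (fun z : ℝ × ℝ => z.2 / m) (νU.prod νV) :=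
    (h.integrable_V.comp_snd νU).div_const m
  refine ⟨hmp.integrable_comp_of_integrable hint, ?_⟩
  have h1 : ∫ z, z.2 / m ∂((iidLaw (νU.prod νV)).map fun a : ℕ → ℝ × ℝ => a n)
      = ∫ a, (a n).2 / m ∂(iidLaw (νU.prod νV)) :=
    integral_map hmp.measurable.aemeasurable (by fun_prop)
  rw [← h1, hmp.map_eq, integral_div, integral_fun_snd (fun x : ℝ => x), h.mean_V]
  simp

include hl hlm

/-- The trajectory from the empty state stays below the one started at the limit state of the
remaining inputs; this is the dominating function for the mean waits. -/
lemma runBack_fst_le : ∀ᵐ a ∂(iidLaw (νU.prod νV)), ∀ n,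
    ‖(runBack l m n (0, 0) a).1‖ ≤ ⨆ k, walk l m a k := by
  filter_upwards [h.ae_tendsto_walk hl hlm] with a ha n
  rw [Real.norm_eq_abs, abs_of_nonneg (runBack_fst_nonneg n le_rfl a)]
  have h1 := runBack_fst_mono (l := l) (m := m) n (z := (0, 0)) (z' := limState l m (drop n a))
    (limState_fst_nonneg (tendsto_walk_drop ha n)) a
  rwa [runBack_limState ha] at h1

lemma integrable_run_fst (n : ℕ) :
    Integrable (fun a => (run l m n (0, 0) a).1) (iidLaw (νU.prod νV)) := by
  have hm1 : Measurable fun a => run l m n (0, 0) a :=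
    (measurable_run l m n).comp measurable_prodMk_left
  have hm2 : Measurable fun a => runBack l m n (0, 0) a :=
    (measurable_runBack l m n).comp measurable_prodMk_left
  have h1 : Integrable (fun a => (runBack l m n (0, 0) a).1) (iidLaw (νU.prod νV)) := by
    refine (h.integrable_iSup_walk hl hlm).mono' hm2.fst.aestronglyMeasurable ?_
    filter_upwards [h.runBack_fst_le hl hlm] with a ha using ha n
  have h2 := (integrable_map_measure (g := fun z : ℝ × ℝ => z.1) (by fun_prop)
    hm2.aemeasurable).2 h1
  rw [← map_run_eq_map_runBack] at h2
  exact (integrable_map_measure (by fun_prop) hm1.aemeasurable).1 h2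

lemma tendsto_integral_run_fst :
    Tendsto (fun n => ∫ a, (run l m n (0, 0) a).1 ∂(iidLaw (νU.prod νV))) atTop
      (𝓝 (∫ a, ⨆ k, walk l m a k ∂(iidLaw (νU.prod νV)))) := by
  have hm1 : ∀ n, Measurable fun a => run l m n (0, 0) a := fun n =>
    (measurable_run l m n).comp measurable_prodMk_left
  have hm2 : ∀ n, Measurable fun a => runBack l m n (0, 0) a := fun n =>
    (measurable_runBack l m n).comp measurable_prodMk_left
  have heq : ∀ n, ∫ a, (run l m n (0, 0) a).1 ∂(iidLaw (νU.prod νV))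
      = ∫ a, (runBack l m n (0, 0) a).1 ∂(iidLaw (νU.prod νV)) := fun n => by
    rw [← integral_map (f := fun z : ℝ × ℝ => z.1) (hm1 n).aemeasurable (by fun_prop),
      ← integral_map (f := fun z : ℝ × ℝ => z.1) (hm2 n).aemeasurable (by fun_prop),
      map_run_eq_map_runBack]
  simp only [heq]
  refine tendsto_integral_of_dominated_convergence _
    (fun n => (hm2 n).fst.aestronglyMeasurable) (h.integrable_iSup_walk hl hlm) (fun n => ?_) ?_
  · filter_upwards [h.runBack_fst_le hl hlm] with a ha using ha n
  · filter_upwards [h.ae_tendsto_walk hl hlm] with a ha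
    refine tendsto_nhds_of_eventually_eq ?_
    filter_upwards [eventually_runBack_eq ha (0, 0)] with n hn
    rw [hn, limState]

lemma integrable_sojourn (n : ℕ) : Integrable (sojourn l m n) (iidLaw (νU.prod νV)) :=
  (h.integrable_run_fst hl hlm n).add (h.integral_service n).1

lemma tendsto_integral_sojourn :
    Tendsto (fun n => ∫ a, sojourn l m n a ∂(iidLaw (νU.prod νV))) atTop
      (𝓝 (∫ a, ⨆ k, walk l m a k ∂(iidLaw (νU.prod νV)) + 1 / m)) := by
  have heq : ∀ n, ∫ a, sojourn l m n a ∂(iidLaw (νU.prod νV))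
      = ∫ a, (run l m n (0, 0) a).1 ∂(iidLaw (νU.prod νV)) + 1 / m := fun n => by
    simp only [sojourn]
    rw [integral_add (h.integrable_run_fst hl hlm n) (h.integral_service n).1,
      (h.integral_service n).2]
  simp only [heq]
  exact (h.tendsto_integral_run_fst hl hlm).add_const _

lemma meanSojourn_nonneg : 0 ≤ ∫ a, ⨆ k, walk l m a k ∂(iidLaw (νU.prod νV)) + 1 / m := by
  refine add_nonneg (integral_nonneg_of_ae ?_) (one_div_nonneg.2 (hl.trans hlm).le)
  filter_upwards [h.ae_tendsto_walk hl hlm] with a ha using limState_fst_nonneg ha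

/-- Mean sojourn times converge and so are o(n); thus customer n departs at nearly its arrival time
on the scale n. -/
lemma tendstoInMeasure_sojourn_div :
    TendstoInMeasure (iidLaw (νU.prod νV)) (fun (n : ℕ) a => sojourn l m n a / n) atTop
      (fun _ => 0) := by
  refine tendstoInMeasure_const_of_tendsto_integral le_rfl
    (fun n => (h.integrable_sojourn hl hlm n).div_const _) ?_ ?_ ?_
  · filter_upwards [h.ae_nonneg] with a ha n
    exact div_nonneg (sojourn_nonneg (hl.trans hlm) n (ha n).2) n.cast_nonneg
  · simp only [integral_div]
    exact (h.tendsto_integral_sojourn hl hlm).div_atTop tendsto_natCast_atTop_atTop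
  · intro ε hε
    filter_upwards [h.ae_nonneg] with a ha
    refine Eventually.of_forall fun n => ?_
    have := div_nonneg (sojourn_nonneg (l := l) (hl.trans hlm) n (ha n).2)
      (Nat.cast_nonneg (α := ℝ) n)
    linarith

lemma integrable_totalSojourn (n : ℕ) : Integrable (totalSojourn l m n) (iidLaw (νU.prod νV)) :=
  integrable_finsetSum _ fun i _ => h.integrable_sojourn hl hlm i

lemma tendsto_integral_totalSojourn_div :
    Tendsto (fun n : ℕ => ∫ a, totalSojourn l m n a / n ∂(iidLaw (νU.prod νV))) atTop
      (𝓝 (∫ a, ⨆ k, walk l m a k ∂(iidLaw (νU.prod νV)) + 1 / m)) := by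
  refine (h.tendsto_integral_sojourn hl hlm).cesaro.congr fun n => ?_
  simp only [integral_div, totalSojourn]
  rw [integral_finsetSum _ fun i _ => h.integrable_sojourn hl hlm i, inv_mul_eq_div]

lemma ae_tendsto_sum_totalSojourn_drop (K : ℕ) :
    ∀ᵐ a ∂(iidLaw (νU.prod νV)), Tendsto (fun j : ℕ =>
      (∑ i ∈ Finset.range j, totalSojourn l m K (drop (K * i) a)) / j) atTop
        (𝓝 (∫ a, totalSojourn l m K a ∂(iidLaw (νU.prod νV)))) := by
  have hid : ∀ i, IdentDistrib (fun a => totalSojourn l m K (drop (K * i) a))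
      (totalSojourn l m K) (iidLaw (νU.prod νV)) (iidLaw (νU.prod νV)) := fun i => by
    refine ⟨by fun_prop, by fun_prop, ?_⟩
    conv_rhs => rw [← (measurePreserving_drop (νU.prod νV) (K * i)).map_eq]
    rw [Measure.map_map (by fun_prop) (by fun_prop)]
    rfl
  have hlln := strong_law_ae_real (fun (i : ℕ) a => totalSojourn l m K (drop (K * i) a))
    ((hid 0).integrable_iff.2 (h.integrable_totalSojourn hl hlm K)) ?_
    (fun i => (hid i).trans (hid 0).symm)
  · rwa [(hid 0).integral_eq] at hlln
  · have aux : ∀ i j : ℕ, i < j → IndepFun (fun a => totalSojourn l m K (drop (K * i) a))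
        (fun a => totalSojourn l m K (drop (K * j) a)) (iidLaw (νU.prod νV)) := by
      intro i j hij
      refine indepFun_of_dependsOn _ (by fun_prop) (by fun_prop) ?_
        (dependsOn_totalSojourn_drop K (K * i)) (dependsOn_totalSojourn_drop K (K * j))
      rw [Finset.disjoint_left]
      intro k hk hk'
      rw [Finset.mem_Ico] at hk hk'
      have : K * i + K ≤ K * j := by
        rw [← Nat.mul_succ]; exact Nat.mul_le_mul_left K hij
      omega
    intro i j hij
    rcases lt_or_gt_of_ne hij with hlt | hlt
    · exact aux i j hlt
    · exact (aux j i hlt).symm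

/-- The means converge by Cesàro averaging. For the almost sure lower bound, cut the customers into
blocks of length `K`, each restarted empty: the blocks are i.i.d., and by superadditivity their sum
is a lower bound. -/
lemma tendstoInMeasure_totalSojourn_div :
    TendstoInMeasure (iidLaw (νU.prod νV)) (fun (n : ℕ) a => totalSojourn l m n a / n) atTop
      (fun _ => ∫ a, ⨆ k, walk l m a k ∂(iidLaw (νU.prod νV)) + 1 / m) := by
  have hm := hl.trans hlm
  have hE := h.tendsto_integral_totalSojourn_div hl hlm
  refine tendstoInMeasure_const_of_tendsto_integral (h.meanSojourn_nonneg hl hlm)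
    (fun n => (h.integrable_totalSojourn hl hlm n).div_const _) ?_ hE ?_
  · filter_upwards [h.ae_nonneg] with a ha n
    exact div_nonneg (Finset.sum_nonneg fun i _ => sojourn_nonneg hm i (ha i).2) n.cast_nonneg
  intro ε hε
  -- `K` is so large that the restarts cost less than ε per customer in the mean.
  obtain ⟨K, hK, hK0⟩ := ((hE.eventually (lt_mem_nhds (sub_lt_self _ hε))).and
    (eventually_gt_atTop 0)).exists
  filter_upwards [h.ae_nonneg, h.ae_tendsto_sum_totalSojourn_drop hl hlm K] with a ha hlim
  have hK0' : (0 : ℝ) < K := Nat.cast_pos.2 hK0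
  have hfloor : Tendsto (fun n : ℕ => ((n / K : ℕ) : ℝ) / n) atTop (𝓝 (1 / K)) := by
    have h1 := (tendsto_nat_floor_mul_div_atTop (R := ℝ) (one_div_nonneg.2 hK0'.le)).comp
      tendsto_natCast_atTop_atTop
    refine h1.congr fun n => ?_
    simp only [Function.comp_apply]
    rw [one_div_mul_eq_div, Nat.floor_div_eq_div]
  have hdiv : Tendsto (fun n : ℕ => n / K) atTop atTop := Nat.tendsto_div_const_atTop hK0.ne'
  have hlim2 := hfloor.mul (hlim.comp hdiv)
  have hval : 1 / (K : ℝ) * ∫ a, totalSojourn l m K a ∂(iidLaw (νU.prod νV))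
      = ∫ a, totalSojourn l m K a / K ∂(iidLaw (νU.prod νV)) := by
    rw [integral_div, one_div_mul_eq_div]
  rw [hval] at hlim2
  filter_upwards [hlim2.eventually (lt_mem_nhds hK), hdiv.eventually (eventually_gt_atTop 0)]
    with n hn hn0
  refine hn.le.trans ?_
  have hj : (0 : ℝ) < (n / K : ℕ) := Nat.cast_pos.2 hn0
  simp only [Function.comp_apply]
  rw [div_mul_div_comm, mul_comm, mul_div_mul_right _ _ hj.ne']
  refine div_le_div_of_nonneg_right ((sum_totalSojourn_drop_le K (n / K) a).trans ?_)
    n.cast_nonneg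
  exact totalSojourn_mono hm (fun i => (ha i).2) (Nat.mul_div_le n K)

end IsPrimitivePair

/-! ### Little's law. -/

section PathwiseQueue

variable {Ω : Type*} (U V : ℕ → Ω → ℝ) (l m : ℝ)

lemma state_eq_run (n : ℕ) (ω : Ω) :
    state U V l m n ω = run l m n (0, 0) (fun i => (U i ω, V i ω)) := by
  induction n with
  | zero => rfl
  | succ n ih => rw [state, run, ih]

lemma departure_eq_add_sojourn (n : ℕ) (ω : Ω) :
    departure U V l m n ω = arrival U l n ω + sojourn l m n (fun i => (U i ω, V i ω)) := by
  rw [departure, state_eq_run, sojourn, add_assoc]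

lemma lintegral_numInSystem (T : ℝ) (ω : Ω) :
    ∫⁻ t in Set.Icc 0 T, numInSystem U V l m t ω
      = ∑' n, volume (Set.Ico (arrival U l n ω) (departure U V l m n ω) ∩ Set.Icc 0 T) := by
  simp only [numInSystem]
  rw [lintegral_tsum fun n => (measurable_const.indicator measurableSet_Ico).aemeasurable]
  refine tsum_congr fun n => ?_
  rw [lintegral_indicator measurableSet_Ico, setLIntegral_one,
    Measure.restrict_apply measurableSet_Ico]

variable {U V l m} {ω : Ω} (hl : 0 < l) (hm : 0 < m) (hU : ∀ i, 0 ≤ U i ω) (hV : ∀ i, 0 ≤ V i ω)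

include hl hU in
lemma monotone_arrival : Monotone fun n => arrival U l n ω :=
  monotone_nat_of_le_succ fun n => by
    rw [arrival, arrival, Finset.sum_range_succ]
    exact le_add_of_nonneg_right (div_nonneg (hU n) hl.le)

include hl hU in
lemma arrival_nonneg (n : ℕ) : 0 ≤ arrival U l n ω :=
  Finset.sum_nonneg fun i _ => div_nonneg (hU i) hl.le

include hm hV in
lemma monotone_departure : Monotone fun n => departure U V l m n ω :=
  monotone_nat_of_le_succ fun n => by
    have h1 : (state U V l m n ω).1 + V n ω / m - U n ω / l ≤ (state U V l m (n + 1) ω).1 :=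
      le_max_left _ _
    have h2 := div_nonneg (hV (n + 1)) hm.le
    have h3 : arrival U l (n + 1) ω = arrival U l n ω + U n ω / l := Finset.sum_range_succ _ _
    rw [departure, departure, h3]
    linarith

variable {T : ℝ} {N : ℕ}

include hl hm hU hV

/-- Customers from `N` on arrive after `T` and contribute nothing; the others contribute at most
their sojourn. -/
lemma lintegral_numInSystem_le (hT : T < arrival U l N ω) :
    ∫⁻ t in Set.Icc 0 T, numInSystem U V l m t ω
      ≤ ENNReal.ofReal (totalSojourn l m N fun i => (U i ω, V i ω)) := by
  rw [lintegral_numInSystem, tsum_eq_sum (s := Finset.range N), totalSojourn,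
    ENNReal.ofReal_sum_of_nonneg fun i _ => sojourn_nonneg hm i (hV i)]
  · refine Finset.sum_le_sum fun n _ => (measure_mono Set.inter_subset_left).trans ?_
    rw [Real.volume_Ico, departure_eq_add_sojourn, add_sub_cancel_left]
  · intro n hn
    have hNn : N ≤ n := by simpa using hn
    have hlt : T < arrival U l n ω := hT.trans_le (monotone_arrival hl hU hNn)
    have hempty : Set.Ico (arrival U l n ω) (departure U V l m n ω) ∩ Set.Icc 0 T = ∅ := by
      ext t
      simp only [Set.mem_inter_iff, Set.mem_Ico, Set.mem_Icc, Set.mem_empty_iff_false, iff_false]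
      rintro ⟨⟨h1, -⟩, -, h2⟩
      linarith
    rw [hempty, measure_empty]

/-- Under FIFO departures are ordered, so all customers before `N` have left by `T` and contribute
their whole sojourn. -/
lemma le_lintegral_numInSystem (hT : departure U V l m N ω ≤ T) :
    ENNReal.ofReal (totalSojourn l m N fun i => (U i ω, V i ω))
      ≤ ∫⁻ t in Set.Icc 0 T, numInSystem U V l m t ω := by
  rw [lintegral_numInSystem, totalSojourn,
    ENNReal.ofReal_sum_of_nonneg fun i _ => sojourn_nonneg hm i (hV i)]
  refine le_trans (Finset.sum_le_sum fun n hn => ?_) (ENNReal.sum_le_tsum (Finset.range N))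
  have hdT : departure U V l m n ω ≤ T :=
    (monotone_departure hm hV (Finset.mem_range.1 hn).le).trans hT
  have hsub : Set.Ico (arrival U l n ω) (departure U V l m n ω) ⊆ Set.Icc 0 T :=
    fun t ht => ⟨(arrival_nonneg hl hU n).trans ht.1, ht.2.le.trans hdT⟩
  rw [Set.inter_eq_left.2 hsub, Real.volume_Ico, departure_eq_add_sojourn, add_sub_cancel_left]

lemma toReal_lintegral_numInSystem_mem {N' : ℕ} (hT : departure U V l m N ω ≤ T)
    (hT' : T < arrival U l N' ω) :
    totalSojourn l m N (fun i => (U i ω, V i ω))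
        ≤ (∫⁻ t in Set.Icc 0 T, numInSystem U V l m t ω).toReal ∧
      (∫⁻ t in Set.Icc 0 T, numInSystem U V l m t ω).toReal
        ≤ totalSojourn l m N' (fun i => (U i ω, V i ω)) := by
  have h1 := lintegral_numInSystem_le hl hm hU hV hT'
  have h2 := le_lintegral_numInSystem hl hm hU hV hT
  have hne : ∫⁻ t in Set.Icc 0 T, numInSystem U V l m t ω ≠ ∞ :=
    (h1.trans_lt ENNReal.ofReal_lt_top).ne
  refine ⟨(ENNReal.ofReal_le_iff_le_toReal hne).1 h2, ?_⟩
  exact ENNReal.toReal_le_of_le_ofReal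
    (Finset.sum_nonneg fun i _ => sojourn_nonneg hm i (hV i)) h1

end PathwiseQueue

/-- The unscaled interarrival times, as coordinates of a sequence of pairs. -/
def coordU (i : ℕ) (a : ℕ → ℝ × ℝ) : ℝ := (a i).1

/-- The unscaled service times, as coordinates of a sequence of pairs. -/
def coordV (i : ℕ) (a : ℕ → ℝ × ℝ) : ℝ := (a i).2

/-- Each inequality needed is strict in the limit: first δ → 0, then κ → 0 for that δ. δ is the
relaxation of the arrival rate and of the mean sojourn, κ the per-customer error in arrival and
departure times; 2δ and δ/2 leave room for rounding customer counts. -/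
lemma exists_pos_margins {l c ε : ℝ} (hl : 0 < l) (hc : 0 < c) (hε : 0 < ε) :
    ∃ δ > 0, ∃ κ > 0, (l + δ) * (c + δ) < l * c + ε ∧ l * c - ε < (l - 2 * δ) * (c - δ) ∧
      δ < c ∧ 2 * δ < l ∧ 1 < (l + δ / 2) * (1 / l - κ) ∧ (l - δ) * (1 / l + 2 * κ) < 1 := by
  have h0 : ∀ᶠ δ in 𝓝[>] (0 : ℝ), 0 < δ := self_mem_nhdsWithin
  have aux : ∀ (f g : ℝ → ℝ), Continuous f → Continuous g → f 0 < g 0 →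
      ∀ᶠ δ in 𝓝[>] (0 : ℝ), f δ < g δ := fun f g hf hg hfg =>
    nhdsWithin_le_nhds (hf.continuousAt.eventually_lt hg.continuousAt hfg)
  obtain ⟨δ, hδ, h1, h2, h3, h4⟩ := (h0.and
    ((aux (fun δ => (l + δ) * (c + δ)) (fun _ => l * c + ε) (by fun_prop) (by fun_prop)
      (by simpa using hε)).and
    ((aux (fun _ => l * c - ε) (fun δ => (l - 2 * δ) * (c - δ)) (by fun_prop) (by fun_prop)
      (by simpa using hε)).and
    ((aux (fun δ => δ) (fun _ => c) (by fun_prop) (by fun_prop) hc).and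
    (aux (fun δ => 2 * δ) (fun _ => l) (by fun_prop) (by fun_prop) (by simpa using hl)))))).exists
  obtain ⟨κ, hκ, h5, h6⟩ := (h0.and
    ((aux (fun _ => 1) (fun κ => (l + δ / 2) * (1 / l - κ)) (by fun_prop) (by fun_prop) (by
      simp only [sub_zero, mul_one_div]
      rw [lt_div_iff₀ hl]; linarith)).and
    (aux (fun κ => (l - δ) * (1 / l + 2 * κ)) (fun _ => 1) (by fun_prop) (by fun_prop) (by
      simp only [mul_zero, add_zero, mul_one_div]
      rw [div_lt_iff₀ hl]; linarith)))).exists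
  exact ⟨δ, hδ, κ, hκ, h1, h2, h3, h4, h5, h6⟩

lemma abs_timeAverage_sub_lt {l m c ε δ κ T : ℝ} {N N' : ℕ} {a : ℕ → ℝ × ℝ}
    (hl : 0 < l) (hm : 0 < m) (ha : ∀ i, 0 ≤ (a i).1 ∧ 0 ≤ (a i).2) (hc : 0 < c) (hT : 0 < T)
    (hδ : 0 < δ) (hκ : 0 < κ)
    (h1 : (l + δ) * (c + δ) < l * c + ε) (h2 : l * c - ε < (l - 2 * δ) * (c - δ))
    (h3 : δ < c) (h5 : 1 < (l + δ / 2) * (1 / l - κ))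
    (h6 : (l - δ) * (1 / l + 2 * κ) < 1)
    (hN : (N : ℝ) / T ≤ l - δ) (hN' : l - 2 * δ < (N : ℝ) / T) (hN0 : 0 < N)
    (hM : (N' : ℝ) / T ≤ l + δ) (hM' : l + δ / 2 < (N' : ℝ) / T)
    (hA : |totalSojourn l m N a / N - c| < δ) (hA' : |totalSojourn l m N' a / N' - c| < δ)
    (hB : |arrival coordU l N a / N - 1 / l| < κ) (hB' : |arrival coordU l N' a / N' - 1 / l| < κ)
    (hS : |sojourn l m N a / N - 0| < κ) :
    |T⁻¹ * (∫⁻ t in Set.Icc 0 T, numInSystem coordU coordV l m t a).toReal - l * c| < ε := by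
  have hNr : (0 : ℝ) < N := Nat.cast_pos.2 hN0
  have hN'r : (0 : ℝ) < N' := by
    have : 0 < (N' : ℝ) / T := lt_trans (by positivity) hM'
    exact (div_pos_iff_of_pos_right hT).1 this
  rw [abs_lt] at hA hA' hB hB' hS
  have hdep : departure coordU coordV l m N a ≤ T := by
    have e1 : departure coordU coordV l m N a = arrival coordU l N a + sojourn l m N a :=
      departure_eq_add_sojourn coordU coordV l m N a
    have e2 : (arrival coordU l N a + sojourn l m N a) / N ≤ 1 / l + 2 * κ := by
      rw [add_div]; linarith [hB.2, hS.2]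
    rw [div_le_iff₀ hNr] at e2
    rw [div_le_iff₀ hT] at hN
    have e3 : 0 < 1 / l + 2 * κ := by positivity
    nlinarith [mul_le_mul_of_nonneg_left hN e3.le]
  have harr : T < arrival coordU l N' a := by
    have e2 : 1 / l - κ < arrival coordU l N' a / N' := by linarith [hB'.1]
    rw [lt_div_iff₀ hN'r] at e2
    rw [lt_div_iff₀ hT] at hM'
    have e3 : 0 < 1 / l - κ := by
      by_contra hcon
      have := mul_nonpos_of_nonneg_of_nonpos (show 0 ≤ l + δ / 2 by positivity) (not_lt.1 hcon)
      linarith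
    nlinarith [mul_lt_mul_of_pos_left hM' e3]
  obtain ⟨g1, g2⟩ := toReal_lintegral_numInSystem_mem (U := coordU) (V := coordV) hl hm
    (fun i => (ha i).1) (fun i => (ha i).2) hdep harr
  change totalSojourn l m N a ≤ _ at g1
  change _ ≤ totalSojourn l m N' a at g2
  set I := (∫⁻ t in Set.Icc 0 T, numInSystem coordU coordV l m t a).toReal
  have k1 : c - δ < totalSojourn l m N a / N := by linarith [hA.1]
  have k2 : totalSojourn l m N' a / N' < c + δ := by linarith [hA'.2]
  rw [lt_div_iff₀ hNr] at k1
  rw [div_lt_iff₀ hN'r] at k2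
  have k3 : (l - 2 * δ) * (c - δ) < T⁻¹ * I := by
    rw [inv_mul_eq_div, lt_div_iff₀ hT]
    rw [lt_div_iff₀ hT] at hN'
    have := mul_lt_mul_of_pos_left hN' (sub_pos.2 h3)
    nlinarith
  have k4 : T⁻¹ * I < (l + δ) * (c + δ) := by
    rw [inv_mul_eq_div, div_lt_iff₀ hT]
    rw [div_le_iff₀ hT] at hM
    have := mul_le_mul_of_nonneg_left hM (show 0 ≤ c + δ by positivity)
    nlinarith
  rw [abs_lt]
  constructor <;> linarith

namespace IsPrimitivePair

variable {νU νV : Measure ℝ} [IsProbabilityMeasure νU] [IsProbabilityMeasure νV]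
  (h : IsPrimitivePair νU νV) {l m : ℝ} (hl : 0 < l) (hlm : l < m)
include h hl hlm

lemma isMeanQueue_coord :
    IsMeanQueue coordU coordV l m (iidLaw (νU.prod νV))
      (l * (∫ a, ⨆ k, walk l m a k ∂(iidLaw (νU.prod νV)) + 1 / m)) := by
  have hm := hl.trans hlm
  set Q := iidLaw (νU.prod νV)
  set c := ∫ a, ⨆ k, walk l m a k ∂Q + 1 / m with hcdef
  have hc : 0 < c := by
    refine add_pos_of_nonneg_of_pos (integral_nonneg_of_ae ?_) (one_div_pos.2 hm)
    filter_upwards [h.ae_tendsto_walk hl hlm] with a ha using limState_fst_nonneg ha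
  have hA := tendstoInMeasure_iff_norm.1 (h.tendstoInMeasure_totalSojourn_div hl hlm)
  have hS := tendstoInMeasure_iff_norm.1 (h.tendstoInMeasure_sojourn_div hl hlm)
  have hB' : TendstoInMeasure Q (fun (n : ℕ) a => arrival coordU l n a / n) atTop
      (fun _ => 1 / l) := by
    refine tendstoInMeasure_of_tendsto_ae (fun n => Measurable.aestronglyMeasurable ?_)
      h.tendsto_arrival_div
    unfold arrival coordU
    fun_prop
  have hB := tendstoInMeasure_iff_norm.1 hB'
  refine tendstoInMeasure_iff_norm.2 fun ε hε => ?_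
  obtain ⟨δ, hδ, κ, hκ, h1, h2, h3, h4, h5, h6⟩ := exists_pos_margins hl hc hε
  have hlδ : 0 < l - δ := by linarith
  have hN : Tendsto (fun T : ℝ => ⌊(l - δ) * T⌋₊) atTop atTop :=
    tendsto_nat_floor_atTop.comp (tendsto_id.const_mul_atTop hlδ)
  have hM : Tendsto (fun T : ℝ => ⌊(l + δ) * T⌋₊) atTop atTop :=
    tendsto_nat_floor_atTop.comp (tendsto_id.const_mul_atTop (by positivity))
  have hN' : Tendsto (fun T : ℝ => (⌊(l - δ) * T⌋₊ : ℝ) / T) atTop (𝓝 (l - δ)) :=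
    tendsto_nat_floor_mul_div_atTop hlδ.le
  have hM' : Tendsto (fun T : ℝ => (⌊(l + δ) * T⌋₊ : ℝ) / T) atTop (𝓝 (l + δ)) :=
    tendsto_nat_floor_mul_div_atTop (by positivity)
  have hsum := ((((hA δ hδ).comp hN).add ((hA δ hδ).comp hM)).add
    (((hB κ hκ).comp hN).add ((hB κ hκ).comp hM))).add ((hS κ hκ).comp hN)
  simp only [add_zero] at hsum
  refine tendsto_of_tendsto_of_tendsto_of_le_of_le' tendsto_const_nhds hsum
    (Eventually.of_forall fun _ => zero_le) ?_
  filter_upwards [eventually_gt_atTop (0 : ℝ), hN.eventually (eventually_gt_atTop 0),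
    hN'.eventually (lt_mem_nhds (show l - 2 * δ < l - δ by linarith)),
    hM'.eventually (lt_mem_nhds (show l + δ / 2 < l + δ by linarith))] with T hT hN0 hNT hMT
  simp only [Function.comp_apply]
  -- Off five bad events (total sojourn and arrival time at both customer counts, last sojourn at
  -- the smaller), the deterministic estimate applies.
  refine le_trans (measure_mono_ae ?_) ((measure_union_le _ _).trans (add_le_add
    ((measure_union_le _ _).trans (add_le_add (measure_union_le _ _) (measure_union_le _ _)))
      le_rfl))
  filter_upwards [h.ae_nonneg] with a ha hbad
  by_contra hgood
  have hgood' : a ∉ (_ : Set (ℕ → ℝ × ℝ)) := hgood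
  simp only [Set.mem_union, Set.mem_ofPred_eq, not_or, not_le, Real.norm_eq_abs] at hgood'
  obtain ⟨⟨⟨a1, a2⟩, b1, b2⟩, s1⟩ := hgood'
  refine absurd (show ε ≤ _ from hbad) (not_le.2 ?_)
  exact abs_timeAverage_sub_lt hl hm ha hc hT hδ hκ h1 h2 h3 h5 h6
    ((div_le_iff₀ hT).2 (Nat.floor_le (by positivity))) hNT hN0
    ((div_le_iff₀ hT).2 (Nat.floor_le (by positivity))) hMT a1 a2 b1 b2 s1

end IsPrimitivePair

section Queue

variable {Ω : Type*} [MeasurableSpace Ω] {P : Measure Ω} [IsProbabilityMeasure P]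
  {U V : ℕ → Ω → ℝ} (hUV : IsInput P U V) (htail : LightTailed P U V) {l m : ℝ} (hl : 0 < l)
  (hlm : l < m)
include hUV htail hl hlm

lemma isMeanQueue :
    IsMeanQueue U V l m P
      (l * (meanWait (P.map (U 0)) (P.map (V 0)) l m + 1 / m)) := by
  have := Measure.isProbabilityMeasure_map (hUV.measurable_U 0).aemeasurable (μ := P)
  have := Measure.isProbabilityMeasure_map (hUV.measurable_V 0).aemeasurable (μ := P)
  have h := hUV.isPrimitivePair htail
  have hQ := h.isMeanQueue_coord hl hlm
  rw [meanWait_eq (h.ae_tendsto_walk hl hlm)]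
  set q := l * (∫ a, ⨆ k, walk l m a k ∂(iidLaw ((P.map (U 0)).prod (P.map (V 0)))) + 1 / m)
  rw [← hUV.map_eq_iidLaw] at hQ
  intro ε hε
  refine tendsto_of_tendsto_of_tendsto_of_le_of_le tendsto_const_nhds (hQ ε hε)
    (fun _ => zero_le) fun T => ?_
  have hm : Measurable fun ω n => (U n ω, V n ω) :=
    measurable_pi_lambda _ fun n => (hUV.measurable_U n).prodMk (hUV.measurable_V n)
  -- Only an upper bound on the bad probability is needed, and this inequality holds without
  -- measurability of the event.
  refine le_trans (le_of_eq ?_) (Measure.le_map_apply hm.aemeasurable _)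
  have hnum : ∀ t ω, numInSystem U V l m t ω
      = numInSystem coordU coordV l m t (fun n => (U n ω, V n ω)) := fun t ω => by
    have h1 : ∀ n, state U V l m n ω = state coordU coordV l m n fun n => (U n ω, V n ω) :=
      fun n => by rw [state_eq_run, state_eq_run]; rfl
    simp only [numInSystem, departure, h1]
    rfl
  simp only [hnum]
  rfl

lemma existsUnique_isMeanQueue : ∃! q, IsMeanQueue U V l m P q := by
  refine ⟨_, isMeanQueue hUV htail hl hlm, fun q hq => ?_⟩
  obtain ⟨ω, hω⟩ := (tendstoInMeasure_ae_unique hq (isMeanQueue hUV htail hl hlm)).exists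
  exact hω

lemma meanQueue_eq :
    meanQueue U V l m P = l * (meanWait (P.map (U 0)) (P.map (V 0)) l m + 1 / m) := by
  have hex := existsUnique_isMeanQueue hUV htail hl hlm
  rw [meanQueue, dif_pos hex.exists]
  exact hex.unique hex.exists.choose_spec (isMeanQueue hUV htail hl hlm)

end Queue

/-! ### The walk as an envelope in the inverse rates. -/

/-- The sum of the first `k` unscaled interarrival times. -/
noncomputable def sumU (a : ℕ → ℝ × ℝ) (k : ℕ) : ℝ := ∑ i ∈ Finset.range k, (a i).1

/-- The sum of the first `k` unscaled service times. -/
noncomputable def sumV (a : ℕ → ℝ × ℝ) (k : ℕ) : ℝ := ∑ i ∈ Finset.range k, (a i).2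

@[fun_prop]
lemma measurable_sumU (k : ℕ) : Measurable fun a => sumU a k := by
  unfold sumU; fun_prop

@[fun_prop]
lemma measurable_sumV (k : ℕ) : Measurable fun a => sumV a k := by
  unfold sumV; fun_prop

section Lines

variable {l m : ℝ} {a : ℕ → ℝ × ℝ}

lemma walk_eq_sum (l m : ℝ) (a : ℕ → ℝ × ℝ) (k : ℕ) :
    walk l m a k = sumV a k / m - sumU a k / l := by
  simp only [walk, sumU, sumV, Finset.sum_sub_distrib, Finset.sum_div]

lemma walk_eq_lineU (l m : ℝ) (a : ℕ → ℝ × ℝ) :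
    (fun k => sumV a k / m - 1 / l * sumU a k) = walk l m a := by
  ext k; rw [walk_eq_sum]; ring

lemma walk_eq_lineV (l m : ℝ) (a : ℕ → ℝ × ℝ) :
    (fun k => -(sumU a k / l) - -(1 / m) * sumV a k) = walk l m a := by
  ext k; rw [walk_eq_sum]; ring

lemma envelopeU_eq (l m : ℝ) (a : ℕ → ℝ × ℝ) :
    envelope (fun k => sumV a k / m) (sumU a) (1 / l) = ⨆ k, walk l m a k :=
  congrArg iSup (walk_eq_lineU l m a)

lemma envelopeV_eq (l m : ℝ) (a : ℕ → ℝ × ℝ) :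
    envelope (fun k => -(sumU a k / l)) (sumV a) (-(1 / m)) = ⨆ k, walk l m a k :=
  congrArg iSup (walk_eq_lineV l m a)

lemma isLineFamilyU (hU : ∀ i, 0 ≤ (a i).1) (h : Tendsto (walk l m a) atTop atBot) :
    IsLineFamily (fun k => sumV a k / m) (sumU a) (1 / l) :=
  ⟨by simp [sumV], by simp [sumU], monotone_nat_of_le_succ fun n => by
    rw [sumU, sumU, Finset.sum_range_succ]; linarith [hU n], by rwa [walk_eq_lineU]⟩

lemma isLineFamilyV (hV : ∀ i, 0 ≤ (a i).2) (h : Tendsto (walk l m a) atTop atBot) :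
    IsLineFamily (fun k => -(sumU a k / l)) (sumV a) (-(1 / m)) :=
  ⟨by simp [sumU], by simp [sumV], monotone_nat_of_le_succ fun n => by
    rw [sumV, sumV, Finset.sum_range_succ]; linarith [hV n], by rwa [walk_eq_lineV]⟩

lemma sumU_firstMax (hl : l ≠ 0) :
    sumU a (firstMax (walk l m a)) = l * (limState l m a).2 := by
  rw [limState, ← Finset.sum_div, mul_div_cancel₀ _ hl, sumU]

/-- At the first maximizer, the wait is `sumV / m - sumU / l` and the age is `sumU / l`. -/
lemma sumV_firstMax (hl : l ≠ 0) (hm : m ≠ 0) (h : Tendsto (walk l m a) atTop atBot) :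
    sumV a (firstMax (walk l m a)) = m * ((limState l m a).1 + (limState l m a).2) := by
  have h1 : (limState l m a).1 = walk l m a (firstMax (walk l m a)) := iSup_eq_firstMax h
  rw [h1, walk_eq_sum, sumU_firstMax hl]
  field_simp
  ring

/-- Move from the first maximizer towards `k`. If `i` is a maximizer and `k` lies beyond it, the
maximum after step `i` exactly cancels the increment, which is a tie unless the interarrival time is
0. Then the walk cannot decrease, so `i + 1` is again a maximizer. -/
lemma sum_eq_of_isMax (hm : 0 < m) (ha : ∀ i, 0 ≤ (a i).1 ∧ 0 ≤ (a i).2)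
    (h : Tendsto (walk l m a) atTop atBot)
    (hties : ∀ i, ¬((limState l m (drop (i + 1) a)).1 + (a i).2 / m = (a i).1 / l ∧
      0 < (a i).1)) {k : ℕ} (hk : ∀ j, walk l m a j ≤ walk l m a k) :
    sumU a k = sumU a (firstMax (walk l m a)) ∧ sumV a k = sumV a (firstMax (walk l m a)) := by
  set τ := firstMax (walk l m a)
  have hτ : walk l m a τ = walk l m a k := le_antisymm (hk τ) (le_firstMax h k)
  have main : ∀ i, τ ≤ i → i ≤ k → sumU a i = sumU a τ ∧ walk l m a i = walk l m a k := by
    intro i hi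
    induction i, hi using Nat.le_induction with
    | base => exact fun _ => ⟨rfl, hτ⟩
    | succ i _ ih =>
      intro hik
      obtain ⟨h1, h2⟩ := ih (by omega)
      have hmax : (limState l m (drop (i + 1) a)).1 = walk l m a k - walk l m a (i + 1) := by
        have h3 : ∀ j, walk l m (drop (i + 1) a) j = walk l m a (i + 1 + j) - walk l m a (i + 1) :=
          fun j => by rw [walk_add]; ring
        have h4 := iSup_eq_of_forall_le (r := walk l m (drop (i + 1) a)) (k := k - (i + 1))
          fun j => by rw [h3, h3, Nat.add_sub_cancel' hik]; exact sub_le_sub_right (hk _) _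
        rw [limState, h4, h3, Nat.add_sub_cancel' hik]
      have hinc : walk l m a (i + 1) = walk l m a i + ((a i).2 / m - (a i).1 / l) :=
        Finset.sum_range_succ _ _
      have hu : (a i).1 = 0 := by
        refine le_antisymm (not_lt.1 fun hpos => hties i ⟨?_, hpos⟩) (ha i).1
        rw [hmax]; linarith
      refine ⟨by rw [← h1, sumU, sumU, Finset.sum_range_succ, hu, add_zero],
        le_antisymm (hk _) ?_⟩
      rw [hinc, hu, h2, zero_div, sub_zero]
      exact le_add_of_nonneg_right (div_nonneg (ha i).2 hm.le)
  have hU := (main k (firstMax_le hk) le_rfl).1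
  refine ⟨hU, ?_⟩
  rw [walk_eq_sum, walk_eq_sum, hU, sub_left_inj] at hτ
  exact ((div_left_inj' hm.ne').1 hτ).symm

end Lines

namespace IsPrimitivePair

variable {νU νV : Measure ℝ} [IsProbabilityMeasure νU] [IsProbabilityMeasure νV]
  (h : IsPrimitivePair νU νV) {l m : ℝ} (hl : 0 < l) (hlm : l < m)
include h hl hlm

lemma ae_isLineFamilyU : ∀ᵐ a ∂(iidLaw (νU.prod νV)),
    IsLineFamily (fun k => sumV a k / m) (sumU a) (1 / l) := by
  filter_upwards [h.ae_nonneg, h.ae_tendsto_walk hl hlm] with a ha hw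
  exact isLineFamilyU (fun i => (ha i).1) hw

lemma ae_isLineFamilyV : ∀ᵐ a ∂(iidLaw (νU.prod νV)),
    IsLineFamily (fun k => -(sumU a k / l)) (sumV a) (-(1 / m)) := by
  filter_upwards [h.ae_nonneg, h.ae_tendsto_walk hl hlm] with a ha hw
  exact isLineFamilyV (fun i => (ha i).2) hw

lemma integrable_envelopeU : Integrable
    (fun a => envelope (fun k => sumV a k / m) (sumU a) (1 / l)) (iidLaw (νU.prod νV)) := by
  simpa only [envelopeU_eq] using h.integrable_iSup_walk hl hlm

lemma integrable_envelopeV : Integrable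
    (fun a => envelope (fun k => -(sumU a k / l)) (sumV a) (-(1 / m))) (iidLaw (νU.prod νV)) := by
  simpa only [envelopeV_eq] using h.integrable_iSup_walk hl hlm

lemma integrable_limState_snd :
    Integrable (fun a => (limState l m a).2) (iidLaw (νU.prod νV)) := by
  -- A faster arrival rate that is still stable: its integrable envelope bounds the age at rate `l`.
  obtain ⟨l', hl', hm'⟩ := exists_between hlm
  have hlt : 1 / l' < 1 / l := one_div_lt_one_div_of_lt hl hl'
  refine (((h.integrable_envelopeU (hl.trans hl') hm').div_const (1 / l - 1 / l')).div_const
    l).mono' (aemeasurable_limState (h.ae_tendsto_walk hl hlm)).snd.aestronglyMeasurable ?_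
  filter_upwards [h.ae_nonneg, h.ae_isLineFamilyU (hl.trans hl') hm'] with a ha hfam
  have h1 := hfam.y_firstMax_le hlt
  have h2 : 0 ≤ (limState l m a).2 := by
    change 0 ≤ ∑ i ∈ Finset.range (firstMax (walk l m a)), (a i).1 / l
    exact Finset.sum_nonneg fun i _ => div_nonneg (ha i).1 hl.le
  rw [walk_eq_lineU, sumU_firstMax hl.ne'] at h1
  rw [Real.norm_eq_abs, abs_of_nonneg h2, le_div_iff₀ hl, mul_comm]
  exact h1

lemma integrable_steadyState_fst :
    Integrable (fun z : ℝ × ℝ => z.1) (steadyState νU νV l m) := by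
  have hd := h.ae_tendsto_walk hl hlm
  rw [steadyState_eq hd, limLaw, integrable_map_measure (by fun_prop) (aemeasurable_limState hd)]
  exact h.integrable_iSup_walk hl hlm

lemma integrable_steadyState_snd :
    Integrable (fun z : ℝ × ℝ => z.2) (steadyState νU νV l m) := by
  have hd := h.ae_tendsto_walk hl hlm
  rw [steadyState_eq hd, limLaw, integrable_map_measure (by fun_prop) (aemeasurable_limState hd)]
  exact h.integrable_limState_snd hl hlm

lemma integral_sumU_firstMax :
    ∫ a, sumU a (firstMax (walk l m a)) ∂(iidLaw (νU.prod νV)) = l * meanAge νU νV l m := by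
  simp only [sumU_firstMax hl.ne']
  rw [integral_const_mul, meanAge_eq (h.ae_tendsto_walk hl hlm)]

lemma integral_sumV_firstMax :
    ∫ a, sumV a (firstMax (walk l m a)) ∂(iidLaw (νU.prod νV))
      = m * (meanWait νU νV l m + meanAge νU νV l m) := by
  have hd := h.ae_tendsto_walk hl hlm
  have heq : ∀ᵐ a ∂(iidLaw (νU.prod νV)), sumV a (firstMax (walk l m a))
      = m * ((limState l m a).1 + (limState l m a).2) := by
    filter_upwards [hd] with a ha using sumV_firstMax hl.ne' (hl.trans hlm).ne' ha
  rw [integral_congr_ae heq, integral_const_mul,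
    integral_add (f := fun a => (limState l m a).1) (h.integrable_iSup_walk hl hlm)
      (h.integrable_limState_snd hl hlm), meanWait_eq hd, meanAge_eq hd]
  rfl

lemma hasDerivWithinAt_meanWait_invRate {S : Set ℝ}
    (hS : ∀ᵐ a ∂(iidLaw (νU.prod νV)), ∀ s₀,
      IsLineFamily (fun k => sumV a k / m) (sumU a) s₀ → s₀ < 1 / l →
      HasDerivWithinAt (envelope (fun k => sumV a k / m) (sumU a))
        (-sumU a (firstMax (walk l m a))) S (1 / l)) :
    HasDerivWithinAt (fun s => ∫ a, envelope (fun k => sumV a k / m) (sumU a) s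
      ∂(iidLaw (νU.prod νV))) (-(l * meanAge νU νV l m)) S (1 / l) := by
  obtain ⟨l', hl', hm'⟩ := exists_between hlm
  have hlt : 1 / l' < 1 / l := one_div_lt_one_div_of_lt hl hl'
  rw [← h.integral_sumU_firstMax hl hlm]
  simp only [← walk_eq_lineU l m]
  refine hasDerivWithinAt_integral_envelope (x := fun a k => sumV a k / m) (y := sumU)
    (by fun_prop) (by fun_prop) (h.ae_isLineFamilyU (hl.trans hl') hm')
    (h.integrable_envelopeU (hl.trans hl') hm') hlt ?_
  filter_upwards [hS, h.ae_isLineFamilyU (hl.trans hl') hm'] with a ha hfam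
  rw [walk_eq_lineU]
  exact ha _ hfam hlt

lemma hasDerivWithinAt_meanWait_service {S : Set ℝ}
    (hS : ∀ᵐ a ∂(iidLaw (νU.prod νV)), ∀ s₀,
      IsLineFamily (fun k => -(sumU a k / l)) (sumV a) s₀ → s₀ < -(1 / m) →
      HasDerivWithinAt (envelope (fun k => -(sumU a k / l)) (sumV a))
        (-sumV a (firstMax (walk l m a))) S (-(1 / m))) :
    HasDerivWithinAt (fun s => ∫ a, envelope (fun k => -(sumU a k / l)) (sumV a) s
      ∂(iidLaw (νU.prod νV))) (-(m * (meanWait νU νV l m + meanAge νU νV l m))) S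
      (-(1 / m)) := by
  obtain ⟨m', hl', hm'⟩ := exists_between hlm
  have hlt : -(1 / m') < -(1 / m) := neg_lt_neg (one_div_lt_one_div_of_lt (hl.trans hl') hm')
  rw [← h.integral_sumV_firstMax hl hlm]
  simp only [← walk_eq_lineV l m]
  refine hasDerivWithinAt_integral_envelope (x := fun a k => -(sumU a k / l)) (y := sumV)
    (by fun_prop) (by fun_prop) (h.ae_isLineFamilyV hl hl')
    (h.integrable_envelopeV hl hl') hlt ?_
  filter_upwards [hS, h.ae_isLineFamilyV hl hl'] with a ha hfam
  rw [walk_eq_lineV]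
  exact ha _ hfam hlt

lemma hasDerivWithinAt_meanWait_invRate_Ici :
    HasDerivWithinAt (fun s => ∫ a, envelope (fun k => sumV a k / m) (sumU a) s
      ∂(iidLaw (νU.prod νV))) (-(l * meanAge νU νV l m)) (Set.Ici (1 / l)) (1 / l) :=
  h.hasDerivWithinAt_meanWait_invRate hl hlm <| ae_of_all _ fun a s₀ hfam hs => by
    rw [← walk_eq_lineU]; exact hfam.hasDerivWithinAt_Ici hs

lemma hasDerivWithinAt_meanWait_service_Ici :
    HasDerivWithinAt (fun s => ∫ a, envelope (fun k => -(sumU a k / l)) (sumV a) s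
      ∂(iidLaw (νU.prod νV))) (-(m * (meanWait νU νV l m + meanAge νU νV l m)))
      (Set.Ici (-(1 / m))) (-(1 / m)) :=
  h.hasDerivWithinAt_meanWait_service hl hlm <| ae_of_all _ fun a s₀ hfam hs => by
    rw [← walk_eq_lineV]; exact hfam.hasDerivWithinAt_Ici hs

/-- The limit state of the shifted inputs is stationary and independent of the first input, so the
hypothesis covers index 0; shift invariance covers the rest. -/
lemma ae_not_tie (hnt : NoTies νU νV l m) : ∀ᵐ a ∂(iidLaw (νU.prod νV)), ∀ i,
    ¬((limState l m (drop (i + 1) a)).1 + (a i).2 / m = (a i).1 / l ∧ 0 < (a i).1) := by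
  have hd := h.ae_tendsto_walk hl hlm
  have h0 : ∀ᵐ a ∂(iidLaw (νU.prod νV)),
      ¬((limState l m (drop 1 a)).1 + (a 0).2 / m = (a 0).1 / l ∧ 0 < (a 0).1) := by
    rw [NoTies, steadyState_eq hd, ← map_limState_drop_one hd, ← compl_compl
      {z : (ℝ × ℝ) × (ℝ × ℝ) | z.1.1 + z.2.2 / m = z.2.1 / l ∧ 0 < z.2.1}, ← mem_ae_iff] at hnt
    exact ae_of_ae_map (aemeasurable_limState_drop_one hd) hnt
  refine ae_all_iff.2 fun i => ?_
  filter_upwards [(measurePreserving_drop (νU.prod νV) i).quasiMeasurePreserving.ae h0] with a ha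
  rwa [drop_drop] at ha

lemma hasDerivWithinAt_meanWait_invRate_univ (hnt : NoTies νU νV l m) :
    HasDerivWithinAt (fun s => ∫ a, envelope (fun k => sumV a k / m) (sumU a) s
      ∂(iidLaw (νU.prod νV))) (-(l * meanAge νU νV l m)) Set.univ (1 / l) := by
  refine h.hasDerivWithinAt_meanWait_invRate hl hlm ?_
  filter_upwards [h.ae_nonneg, h.ae_tendsto_walk hl hlm, h.ae_not_tie hl hlm hnt]
    with a ha hw hties s₀ hfam hs
  rw [← walk_eq_lineU]
  refine hfam.hasDerivWithinAt_univ hs fun k hk => ?_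
  simp only [congrFun (walk_eq_lineU l m a)] at hk
  rw [walk_eq_lineU]
  exact (sum_eq_of_isMax (hl.trans hlm) ha hw hties hk).1

lemma hasDerivWithinAt_meanWait_service_univ (hnt : NoTies νU νV l m) :
    HasDerivWithinAt (fun s => ∫ a, envelope (fun k => -(sumU a k / l)) (sumV a) s
      ∂(iidLaw (νU.prod νV))) (-(m * (meanWait νU νV l m + meanAge νU νV l m)))
      Set.univ (-(1 / m)) := by
  refine h.hasDerivWithinAt_meanWait_service hl hlm ?_
  filter_upwards [h.ae_nonneg, h.ae_tendsto_walk hl hlm, h.ae_not_tie hl hlm hnt]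
    with a ha hw hties s₀ hfam hs
  rw [← walk_eq_lineV]
  refine hfam.hasDerivWithinAt_univ hs fun k hk => ?_
  simp only [congrFun (walk_eq_lineV l m a)] at hk
  rw [walk_eq_lineV]
  exact (sum_eq_of_isMax (hl.trans hlm) ha hw hties hk).2

lemma meanWait_eq_integral_envelopeU : meanWait νU νV l m
    = ∫ a, envelope (fun k => sumV a k / m) (sumU a) (1 / l) ∂(iidLaw (νU.prod νV)) := by
  simp only [envelopeU_eq]
  exact meanWait_eq (h.ae_tendsto_walk hl hlm)

lemma meanWait_eq_integral_envelopeV : meanWait νU νV l m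
    = ∫ a, envelope (fun k => -(sumU a k / l)) (sumV a) (-(1 / m)) ∂(iidLaw (νU.prod νV)) := by
  simp only [envelopeV_eq]
  exact meanWait_eq (h.ae_tendsto_walk hl hlm)

end IsPrimitivePair

/-! ### Chain rule for the objective. -/

section Objective

variable {Ω : Type*} [MeasurableSpace Ω] {P : Measure Ω} [IsProbabilityMeasure P]
  {U V : ℕ → Ω → ℝ} (hUV : IsInput P U V) (htail : LightTailed P U V) (h0 : ℝ) {lam c : ℝ → ℝ}
  {mu p : ℝ} (hpos : 0 < lam p) (hstable : lam p < mu)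
include hUV htail hpos hstable

lemma objective_eq :
    objective P U V h0 lam c mu p
      = h0 * (lam p * (meanWait (P.map (U 0)) (P.map (V 0)) (lam p) mu + 1 / mu))
        + c mu - p * lam p := by
  rw [objective, meanQueue_eq hUV htail hpos hstable]

lemma hasDerivWithinAt_objective_fee {S S' : Set ℝ} {lam' : ℝ}
    (hlam : HasDerivWithinAt lam lam' S p) (hlam_pos : ∀ q ∈ S, 0 < lam q)
    (hmaps : Set.MapsTo (fun q => 1 / lam q) S S')
    (hG : HasDerivWithinAt (fun s => ∫ a, envelope (fun k => sumV a k / mu) (sumU a) s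
      ∂(iidLaw ((P.map (U 0)).prod (P.map (V 0)))))
      (-(lam p * meanAge (P.map (U 0)) (P.map (V 0)) (lam p) mu)) S' (1 / lam p)) :
    HasDerivWithinAt (fun q => objective P U V h0 lam c mu q)
      (-lam p - p * lam' + h0 * lam' * (meanWait (P.map (U 0)) (P.map (V 0)) (lam p) mu
        + meanAge (P.map (U 0)) (P.map (V 0)) (lam p) mu + 1 / mu)) S p := by
  have := Measure.isProbabilityMeasure_map (hUV.measurable_U 0).aemeasurable (μ := P)
  have := Measure.isProbabilityMeasure_map (hUV.measurable_V 0).aemeasurable (μ := P)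
  have h := hUV.isPrimitivePair htail
  have hinv : HasDerivWithinAt (fun q => 1 / lam q) (-lam' / lam p ^ 2) S p := by
    simpa only [one_div] using hlam.fun_inv hpos.ne'
  have hcomp := hG.comp p hinv hmaps
  have hmain := (((hlam.mul (hcomp.add_const (1 / mu))).const_mul h0).add_const (c mu)).sub
    ((hasDerivWithinAt_id p S).mul hlam)
  have hval : objective P U V h0 lam c mu p = _ := objective_eq hUV htail h0 hpos hstable
  rw [h.meanWait_eq_integral_envelopeU hpos hstable] at hval ⊢
  refine (hmain.congr_deriv ?_).congr_of_eventuallyEq ?_ hval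
  · simp only [Function.comp_apply, id]
    field_simp
    ring
  · filter_upwards [self_mem_nhdsWithin,
      hlam.continuousWithinAt.eventually (gt_mem_nhds hstable)] with q hq hq'
    rw [objective_eq hUV htail h0 (hlam_pos q hq) hq',
      h.meanWait_eq_integral_envelopeU (hlam_pos q hq) hq']
    rfl

lemma hasDerivWithinAt_objective_service {S S' : Set ℝ} {c' : ℝ}
    (hc : HasDerivWithinAt c c' S mu)
    (hmaps : Set.MapsTo (fun y => -(1 / y)) S S')
    (hG : HasDerivWithinAt (fun s => ∫ a, envelope (fun k => -(sumU a k / lam p)) (sumV a) s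
      ∂(iidLaw ((P.map (U 0)).prod (P.map (V 0)))))
      (-(mu * (meanWait (P.map (U 0)) (P.map (V 0)) (lam p) mu
        + meanAge (P.map (U 0)) (P.map (V 0)) (lam p) mu))) S' (-(1 / mu))) :
    HasDerivWithinAt (fun y => objective P U V h0 lam c y p)
      (c' - h0 * (lam p / mu) * (meanWait (P.map (U 0)) (P.map (V 0)) (lam p) mu
        + meanAge (P.map (U 0)) (P.map (V 0)) (lam p) mu + 1 / mu)) S mu := by
  have := Measure.isProbabilityMeasure_map (hUV.measurable_U 0).aemeasurable (μ := P)
  have := Measure.isProbabilityMeasure_map (hUV.measurable_V 0).aemeasurable (μ := P)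
  have h := hUV.isPrimitivePair htail
  have hmu : 0 < mu := hpos.trans hstable
  have hinv : HasDerivWithinAt (fun y : ℝ => 1 / y) (-1 / mu ^ 2) S mu := by
    simpa only [one_div, id] using (hasDerivWithinAt_id mu S).fun_inv hmu.ne'
  have hcomp := hG.comp mu hinv.neg hmaps
  have hmain := ((((hcomp.add hinv).const_mul (lam p)).const_mul h0).add hc).sub_const (p * lam p)
  have hval : objective P U V h0 lam c mu p = _ := objective_eq hUV htail h0 hpos hstable
  rw [h.meanWait_eq_integral_envelopeV hpos hstable] at hval
  refine (hmain.congr_deriv ?_).congr_of_eventuallyEq ?_ hval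
  · field_simp
    ring
  · filter_upwards [nhdsWithin_le_nhds (lt_mem_nhds hstable)] with y hy
    rw [objective_eq hUV htail h0 hpos hy, h.meanWait_eq_integral_envelopeV hpos hy]
    rfl

end Objective

end GIGIOne

theorem mainTheorem4 {Ω : Type*} [MeasurableSpace Ω] (P : Measure Ω) [IsProbabilityMeasure P]
    (U V : ℕ → Ω → ℝ) (hUV : GIGIOne.IsInput P U V) (htail : GIGIOne.LightTailed P U V)
    (h0 : ℝ) (lam c : ℝ → ℝ) (muL muU pL pU : ℝ)
    (hmu : muL < muU) (hp : pL < pU)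
    (hlam : ContDiffOn ℝ 1 lam (Set.Icc pL pU)) (hlam_anti : AntitoneOn lam (Set.Icc pL pU))
    (hlam_pos : ∀ q ∈ Set.Icc pL pU, 0 < lam q)
    (hc : ContDiffOn ℝ 1 c (Set.Icc muL muU)) (hc_mono : MonotoneOn c (Set.Icc muL muU))
    (mu p : ℝ) (hmu_mem : mu ∈ Set.Icc muL muU) (hp_mem : p ∈ Set.Icc pL pU)
    (hstable : lam p < mu) :
    let νU : Measure ℝ := P.map (U 0)
    let νV : Measure ℝ := P.map (V 0)
    let f : ℝ → ℝ → ℝ := GIGIOne.objective P U V h0 lam c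
    let EW : ℝ := GIGIOne.meanWait νU νV (lam p) mu
    let EX : ℝ := GIGIOne.meanAge νU νV (lam p) mu
    let lam' : ℝ := derivWithin lam (Set.Icc pL pU) p
    let c' : ℝ := derivWithin c (Set.Icc muL muU) mu
    let Dp : ℝ := -lam p - p * lam' + h0 * lam' * (EW + EX + 1 / mu)
    let Dmu : ℝ := c' - h0 * (lam p / mu) * (EW + EX + 1 / mu)
    -- the steady-state quantities are well defined and finite, and `f` has the form
    -- given by Little's law
    (∃! π, GIGIOne.IsSteadyState νU νV (lam p) mu π) ∧
    Integrable (fun z : ℝ × ℝ => z.1) (GIGIOne.steadyState νU νV (lam p) mu) ∧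
    Integrable (fun z : ℝ × ℝ => z.2) (GIGIOne.steadyState νU νV (lam p) mu) ∧
    (∃! q, GIGIOne.IsMeanQueue U V (lam p) mu P q) ∧
    f mu p = h0 * lam p * (EW + 1 / mu) + c mu - p * lam p ∧
    -- the right-hand partial derivatives always exist and are given by the formulas
    HasDerivWithinAt (fun q => f mu q) Dp (Set.Icc p pU) p ∧
    HasDerivWithinAt (fun y => f y p) Dmu (Set.Icc mu muU) mu ∧
    -- wherever `f` has a partial derivative, it is given by the formula
    (p < pU → DifferentiableWithinAt ℝ (fun q => f mu q) (Set.Icc pL pU) p →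
      HasDerivWithinAt (fun q => f mu q) Dp (Set.Icc pL pU) p) ∧
    (mu < muU → DifferentiableWithinAt ℝ (fun y => f y p) (Set.Icc muL muU) mu →
      HasDerivWithinAt (fun y => f y p) Dmu (Set.Icc muL muU) mu) ∧
    -- `f` does have both partial derivatives if there are no ties in steady state
    (GIGIOne.NoTies νU νV (lam p) mu →
      HasDerivWithinAt (fun q => f mu q) Dp (Set.Icc pL pU) p ∧
      HasDerivWithinAt (fun y => f y p) Dmu (Set.Icc muL muU) mu) := by
  intro νU νV f EW EX lam' c' Dp Dmu
  have := Measure.isProbabilityMeasure_map (hUV.measurable_U 0).aemeasurable (μ := P)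
  have := Measure.isProbabilityMeasure_map (hUV.measurable_V 0).aemeasurable (μ := P)
  have h : GIGIOne.IsPrimitivePair νU νV := hUV.isPrimitivePair htail
  have hpos := hlam_pos p hp_mem
  have hdrift := h.ae_tendsto_walk hpos hstable
  have hlamd : HasDerivWithinAt lam lam' (Set.Icc pL pU) p :=
    (hlam.differentiableOn one_ne_zero p hp_mem).hasDerivWithinAt
  have hcd : HasDerivWithinAt c c' (Set.Icc muL muU) mu :=
    (hc.differentiableOn one_ne_zero mu hmu_mem).hasDerivWithinAt
  have hsubp : Set.Icc p pU ⊆ Set.Icc pL pU := Set.Icc_subset_Icc_left hp_mem.1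
  have hsubmu : Set.Icc mu muU ⊆ Set.Icc muL muU := Set.Icc_subset_Icc_left hmu_mem.1
  have hrp : HasDerivWithinAt (fun q => f mu q) Dp (Set.Icc p pU) p := by
    refine GIGIOne.hasDerivWithinAt_objective_fee hUV htail h0 hpos hstable
      (hlamd.mono hsubp) (fun q hq => hlam_pos q (hsubp hq)) (fun q hq => ?_)
      (h.hasDerivWithinAt_meanWait_invRate_Ici hpos hstable)
    -- Monotonicity of `lam` enters here: raising the fee can only increase the inverse rate, so the
    -- right derivative in it suffices.
    exact one_div_le_one_div_of_le (hlam_pos q (hsubp hq)) (hlam_anti hp_mem (hsubp hq) hq.1)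
  have hrmu : HasDerivWithinAt (fun y => f y p) Dmu (Set.Icc mu muU) mu := by
    refine GIGIOne.hasDerivWithinAt_objective_service hUV htail h0 hpos hstable
      (hcd.mono hsubmu) (fun y hy => ?_) (h.hasDerivWithinAt_meanWait_service_Ici hpos hstable)
    exact neg_le_neg (one_div_le_one_div_of_le (hpos.trans hstable) hy.1)
  refine ⟨⟨_, GIGIOne.isSteadyState_limLaw hdrift, fun π hπ => hπ.eq_limLaw hdrift⟩,
    h.integrable_steadyState_fst hpos hstable, h.integrable_steadyState_snd hpos hstable,
    GIGIOne.existsUnique_isMeanQueue hUV htail hpos hstable, ?_, hrp, hrmu, ?_, ?_, ?_⟩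
  · rw [mul_assoc]
    exact GIGIOne.objective_eq hUV htail h0 hpos hstable
  · intro hlt hd
    -- Derivatives are unique on a nondegenerate interval to the right, so any derivative on the
    -- full interval equals the right-hand one.
    have hu := (uniqueDiffOn_Icc hlt _ ⟨le_rfl, hlt.le⟩).eq_deriv _
      (hd.hasDerivWithinAt.mono hsubp) hrp
    exact hu ▸ hd.hasDerivWithinAt
  · intro hlt hd
    have hu := (uniqueDiffOn_Icc hlt _ ⟨le_rfl, hlt.le⟩).eq_deriv _
      (hd.hasDerivWithinAt.mono hsubmu) hrmu
    exact hu ▸ hd.hasDerivWithinAt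
  · intro hnt
    exact ⟨GIGIOne.hasDerivWithinAt_objective_fee hUV htail h0 hpos hstable
        hlamd hlam_pos (Set.mapsTo_univ _ _)
        (h.hasDerivWithinAt_meanWait_invRate_univ hpos hstable hnt),
      GIGIOne.hasDerivWithinAt_objective_service hUV htail h0 hpos hstable
        hcd (Set.mapsTo_univ _ _)
        (h.hasDerivWithinAt_meanWait_service_univ hpos hstable hnt)⟩
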